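/- Conventions. A CAT(0) space is a geodesic metric space in which geodesic triangles are no fatter than their comparison triangles in the Euclidean plane; completeness is not assumed. A geodesic is an isometric embedding $\gamma\colon I\to X$ of a nonempty closed interval $I\subseteq\mathbb R$, possibly infinite; it is a ray if $I=[0,\infty)$ and a line if $I=\mathbb R$. We also write $\gamma$ for its image, $\pi_\gamma$ for the nearest point projection of $X$ to $\gamma$, $[x,y]$ for the geodesic from $x$ to $y$, and $N_r(\gamma)=\{x : d(x,\gamma)<r\}$. A $(K,L)$-quasi-geodesic with endpoints on $\gamma$ is a (not necessarily continuous) map $\sigma\colon[a,b]\to X$ with $\frac1K|s-t|-L\le d(\sigma(s),\sigma(t))\le K|s-t|+L$ for all $s,t\in[a,b]$ and $\sigma(a),\sigma(b)\in\gamma$. A geodesic $\gamma$ is * $D$-contracting if for all $x,y\in X$, $d(x,y)<d(x,\pi_\gamma(x))$ implies $d(\pi_\gamma(x),\pi_\gamma(y))<D$; * $M$-Morse, for a function $M(K,L)$, if for all $K\ge1$, $L\ge0$ every $(K,L)$-quasi-geodesic with endpoints on $\gamma$ is contained in $N_{M(K,L)}(\gamma)$; * $\delta$-slim if $d(\pi_\gamma(x),[x,y])<\delta$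 for all $x\in X$ and $y\in\gamma$. It is contracting, Morse, or slim if it is so for some $D$, $M$, or $\delta$. For a ray or line $\gamma$, let $\rho_\gamma(r,t)\in[0,\infty]$ be the infimum of the lengths of all continuous paths from $\gamma(t-r)$ to $\gamma(t+r)$ lying outside the open ball of radius $r$ about $\gamma(t)$ (with $\inf\emptyset=\infty$). The lower divergence of $\gamma$ is $\mathrm{ldiv}_\gamma(r)=\inf_t\rho_\gamma(r,t)$, where $t$ ranges over all $t>r$ if $\gamma$ is a ray and over all $t\in\mathbb R$ if $\gamma$ is a line. It is superlinear if $\mathrm{ldiv}_\gamma(r)/r\to\infty$ as $r\to\infty$, and at least quadratic if there is $c>0$ with $\mathrm{ldiv}_\gamma(r)\ge c\,r^2$ for all sufficiently large $r$. Theorem. (a) Let $X$ be a CAT(0) space and $\alpha\subset X$ a geodesic ray or line. Then the following are equivalent: (1) $\alpha$ is contracting; (2) $\alpha$ is Morse; (3) $\alpha$ is slim; (4) $\alpha$ has superlinear lower divergence; (5) $\alpha$ has at least quadratic lower divergence. (b) The contraction constant and the Morse function determine each other, for all geodesics $\gamma$ (segments, rays or lines) in all CAT(0) spaces $X$: for every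 $D$ there is a function $M$, depending only on $D$, such that every $D$-contracting geodesic in every CAT(0) space is $M$-Morse; and, for every function $M$, every $M$-Morse geodesic in every CAT(0) space is $D$-contracting with $D=80\,M(32,0)$. -/

import Mathlib

open Set Filter Topology

universe u

namespace CatZero

section Basic

variable {X : Type u} [MetricSpace X]

/-- `γ`, restricted to the set `I` of parameters (in use: a closed interval), is a geodesic:
an isometric embedding of `I` into `X`.  The values of `γ` outside `I` play no role. -/
def IsGeodesicOn (I : Set ℝ) (γ : ℝ → X) : Prop :=
  ∀ s ∈ I, ∀ t ∈ I, dist (γ s) (γ t) = |s - t|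

/-- Any two points of `X` are joined by a geodesic. -/
def IsGeodesicSpace (X : Type u) [MetricSpace X] : Prop :=
  ∀ x y : X, ∃ c : ℝ → X,
    IsGeodesicOn (Icc 0 (dist x y)) c ∧ c 0 = x ∧ c (dist x y) = y

/-- The segment `[x, y]`.  In a geodesic space it consists of the points that lie on some
geodesic from `x` to `y` (see `mem_seg_iff`); in a CAT(0) space that geodesic is unique. -/
def seg (x y : X) : Set X := {p | dist x p + dist p y = dist x y}

theorem mem_seg_iff (hX : IsGeodesicSpace X) (x y p : X) :
    p ∈ seg x y ↔ ∃ c : ℝ → X, IsGeodesicOn (Icc 0 (dist x y)) c ∧ c 0 = x ∧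
      c (dist x y) = y ∧ p ∈ c '' Icc 0 (dist x y) := by
  constructor
  · intro hp
    have hp' : dist x p + dist p y = dist x y := hp
    obtain ⟨c₁, g₁, a₁, b₁⟩ := hX x p
    obtain ⟨c₂, g₂, a₂, b₂⟩ := hX p y
    have n₁ : 0 ≤ dist x p := dist_nonneg
    have n₂ : 0 ≤ dist p y := dist_nonneg
    set c : ℝ → X := fun s => if s ≤ dist x p then c₁ s else c₂ (s - dist x p) with hc
    have key : ∀ s ∈ Icc 0 (dist x y), ∀ t ∈ Icc 0 (dist x y), s ≤ t →
        dist (c s) (c t) = |s - t| := by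
      rintro s ⟨s0, s1⟩ t ⟨t0, t1⟩ hst
      by_cases ht : t ≤ dist x p
      · have hs : s ≤ dist x p := hst.trans ht
        simp only [hc, if_pos hs, if_pos ht]
        exact g₁ s ⟨s0, hs⟩ t ⟨t0, ht⟩
      · by_cases hs : s ≤ dist x p
        · simp only [hc, if_pos hs, if_neg ht]
          push Not at ht
          have e₁ := g₁ s ⟨s0, hs⟩ (dist x p) ⟨n₁, le_rfl⟩
          have e₂ := g₁ 0 ⟨le_rfl, n₁⟩ s ⟨s0, hs⟩
          have e₃ := g₂ 0 ⟨le_rfl, n₂⟩ (t - dist x p) ⟨by linarith, by linarith⟩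
          have e₄ := g₂ (t - dist x p) ⟨by linarith, by linarith⟩ (dist p y) ⟨n₂, le_rfl⟩
          rw [b₁, abs_of_nonpos (by linarith)] at e₁
          rw [a₁, abs_of_nonpos (by linarith)] at e₂
          rw [a₂, abs_of_nonpos (by linarith)] at e₃
          rw [b₂, abs_of_nonpos (by linarith)] at e₄
          rw [abs_of_nonpos (by linarith)]
          have u₁ := dist_triangle (c₁ s) p (c₂ (t - dist x p))
          have u₂ := dist_triangle x (c₁ s) y
          have u₃ := dist_triangle (c₁ s) (c₂ (t - dist x p)) y
          linarith
        · simp only [hc, if_neg hs, if_neg ht]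
          push Not at hs ht
          rw [g₂ _ ⟨by linarith, by linarith⟩ _ ⟨by linarith, by linarith⟩]
          congr 1
          ring
    refine ⟨c, ?_, ?_, ?_, ⟨dist x p, ⟨n₁, by linarith⟩, ?_⟩⟩
    · intro s hs t ht
      rcases le_total s t with h | h
      · exact key s hs t ht h
      · rw [dist_comm, abs_sub_comm]
        exact key t ht s hs h
    · simp only [hc, if_pos n₁, a₁]
    · by_cases h : dist x y ≤ dist x p
      · have h0 : dist p y = 0 := by linarith
        have hpy : p = y := dist_eq_zero.mp h0
        have hxy : dist x y = dist x p := by rw [hpy]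
        simp only [hc, if_pos h]
        rw [hxy, b₁, hpy]
      · simp only [hc, if_neg h]
        rw [← hp', add_sub_cancel_left, b₂]
    · simp only [hc, if_pos le_rfl, b₁]
  · rintro ⟨c, hc, h0, h1, s, ⟨s0, s1⟩, rfl⟩
    have n : 0 ≤ dist x y := dist_nonneg
    have e₁ := hc 0 ⟨le_rfl, n⟩ s ⟨s0, s1⟩
    have e₂ := hc s ⟨s0, s1⟩ (dist x y) ⟨n, le_rfl⟩
    rw [h0, abs_of_nonpos (by linarith)] at e₁
    rw [h1, abs_of_nonpos (by linarith)] at e₂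
    change dist x (c s) + dist (c s) y = dist x y
    linarith

/-- A CAT(0) space: a geodesic metric space in which every geodesic triangle is at least as thin
as its comparison triangle in the Euclidean plane.  Here `p` and `q` are points on two sides
`[x, y]` and `[x, z]` of a triangle in `X`, the points `x' y' z'` span a comparison triangle, and
`p' q'` are the comparison points of `p q`.  (Two points on one and the same geodesic side have
the same distance as their comparison points, so nothing has to be required of them.) -/
structure IsCAT0 (X : Type u) [MetricSpace X] : Prop where
  geodesic : IsGeodesicSpace X
  comparison : ∀ (x y z p q : X) (x' y' z' p' q' : EuclideanSpace ℝ (Fin 2)),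
    p ∈ seg x y → q ∈ seg x z →
    dist x' y' = dist x y → dist x' z' = dist x z → dist y' z' = dist y z →
    dist x' p' = dist x p → dist p' y' = dist p y →
    dist x' q' = dist x q → dist q' z' = dist q z →
    dist p q ≤ dist p' q'

/-- `p` is the nearest point projection of `x` to `A`.  If `A` is the image of a geodesic defined
on a nonempty closed interval of a CAT(0) space, there is exactly one such `p` for each `x`. -/
def IsProj (A : Set X) (x p : X) : Prop := p ∈ A ∧ ∀ q ∈ A, dist x p ≤ dist x q

/-- `A` (the image of a geodesic) is `D`-contracting. -/
def IsContracting (D : ℝ) (A : Set X) : Prop :=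
  ∀ x y p q : X, IsProj A x p → IsProj A y q → dist x y < dist x p → dist p q < D

/-- `σ`, restricted to the interval `[a, b]`, is a (not necessarily continuous)
`(K, L)`-quasi-geodesic. -/
def IsQuasiGeodesicOn (K L a b : ℝ) (σ : ℝ → X) : Prop :=
  ∀ s ∈ Icc a b, ∀ t ∈ Icc a b,
    1 / K * |s - t| - L ≤ dist (σ s) (σ t) ∧ dist (σ s) (σ t) ≤ K * |s - t| + L

/-- `A` (the image of a geodesic) is `M`-Morse: for `K ≥ 1` and `L ≥ 0` every
`(K, L)`-quasi-geodesic with endpoints on `A` lies in the (open) `M K L`-neighbourhood of `A`. -/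
def IsMorse (M : ℝ → ℝ → ℝ) (A : Set X) : Prop :=
  ∀ K L : ℝ, 1 ≤ K → 0 ≤ L → ∀ (a b : ℝ) (σ : ℝ → X), a ≤ b → IsQuasiGeodesicOn K L a b σ →
    σ a ∈ A → σ b ∈ A → σ '' Icc a b ⊆ Metric.thickening (M K L) A

/-- `A` (the image of a geodesic) is `δ`-slim: the projection of `x` to `A` is at distance less
than `δ` from the segment `[x, y]`, for all `x` in the space and `y` on `A`. -/
def IsSlim (δ : ℝ) (A : Set X) : Prop :=
  ∀ x y p : X, y ∈ A → IsProj A x p → Metric.infDist p (seg x y) < δ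

/-- The infimum of the lengths of all paths from `γ (t - r)` to `γ (t + r)` that lie outside the
open ball of radius `r` about `γ t`; it is `∞` if there is no such path of finite length. -/
noncomputable def detour (γ : ℝ → X) (r t : ℝ) : ENNReal :=
  ⨅ (β : Path (γ (t - r)) (γ (t + r))) (_ : ∀ s, r ≤ dist (β s) (γ t)), eVariationOn β univ

/-- The lower divergence of a geodesic `γ` with parameter set `I`, as a function of `r`.  The
centre `γ t` ranges over all of `γ`, subject to `t - r` and `t + r` being interior parameters:
for a ray, `I = [0, ∞)`, this says `t > r`, and for a line it is no restriction. -/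
noncomputable def lowerDivergence (I : Set ℝ) (γ : ℝ → X) (r : ℝ) : ENNReal :=
  ⨅ (t : ℝ) (_ : t - r ∈ interior I ∧ t + r ∈ interior I), detour γ r t

end Basic

/-- `f r / r → ∞` as `r → ∞`. -/
def IsSuperlinear (f : ℝ → ENNReal) : Prop :=
  Tendsto (fun r => f r / ENNReal.ofReal r) atTop (𝓝 ⊤)

/-- `f r ≥ c * r ^ 2` for some `c > 0` and all large `r`. -/
def IsAtLeastQuadratic (f : ℝ → ENNReal) : Prop :=
  ∃ c : ℝ, 0 < c ∧ ∀ᶠ r in atTop, ENNReal.ofReal (c * r ^ 2) ≤ f r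

end CatZero

/-!
Everything is reduced to two consequences of the comparison axiom: a law of cosines for points on
two sides of a triangle (`IsCAT0.dist_sq_le`), and the fact that the nearest point projection to a
convex set makes angles of at least `π / 2` and does not increase distances (`IsCAT0.pythagoras`,
`IsCAT0.dist_proj_le`).  The height of a point is its distance to the geodesic `A`.

Slim implies contracting (`IsSlim.isContracting`).  Let `p`, `q` be the projections of `x`, `y`, and
`o` the midpoint of `[p, q]`.  If `d(p, q)` is large compared to the slimness constant, `[o, x]` and
`[o, y]` leave `o` in nearly opposite directions, so the comparison angle at `o` is at least
`π / 2`, and `d(x, y) ≥ d(x, p)`.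

Morse implies slim (`IsMorse.isSlim`).  If `[x, y]`, with `y ∈ A`, avoids a large ball about the
projection `p` of `x`, a broken geodesic with four pieces goes up `[p, x]`, crosses over to `[x, y]`,
follows it down to height `M(32, 0)`, and then descends to `A`.  With the right place for the
crossing it is a `(32, 0)`-quasi-geodesic, although it is not contained in the
`M(32, 0)`-neighbourhood of `A`.  The two constants multiply to `14 * 4 ≤ 80`.

Contracting implies Morse (`IsContracting.isMorse`).  During an excursion of a quasi-geodesic above
a suitable height, its projection moves too slowly to keep up with the linear lower bound, which
limits the duration of the excursion in terms of `D`, `K` and `L`.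

Contracting implies quadratic divergence (`IsContracting.isAtLeastQuadratic`).  A path around the
ball of radius `r` spends a length of at least `r / 2` on each advance of its projection by `D`,
and in the middle of the ball about `r / D` such advances are needed.

Superlinear divergence implies contracting (`IsSuperlinear.exists_isContracting`).  If `A` is not
`4 r`-contracting, there is a segment `[x, z]` at height at least `r` whose end points project to
points of `A` at distance about `4 r` (`IsCAT0.exists_high_segment`).  A broken geodesic as above
then gives a path around a ball of radius `r` of length at most `114 * r`
(`IsCAT0.hasDetour_of_height`, `IsCAT0.lowerDivergence_le`).
-/

namespace CatZero

/-! ### Comparison in coordinates -/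

section Comparison

variable {X : Type u} [MetricSpace X] {x y z w p q : X} {s t : ℝ}

theorem exists_comparison_triangle {a b c : ℝ} (ha : 0 ≤ a) (hb : 0 ≤ b) (hc : 0 ≤ c)
    (h₁ : a ≤ b + c) (h₂ : b ≤ a + c) (h₃ : c ≤ a + b) :
    ∃ u v : EuclideanSpace ℝ (Fin 2), ‖u‖ = a ∧ ‖v‖ = b ∧ ‖u - v‖ = c := by
  rcases ha.eq_or_lt with rfl | ha'
  · have hbc : b = c := by linarith
    subst hbc
    refine ⟨0, !₂[b, 0], by simp, ?_, ?_⟩ <;>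
      simp [EuclideanSpace.norm_eq, Fin.sum_univ_two, Real.sqrt_sq hb]
  · set k := (a ^ 2 + b ^ 2 - c ^ 2) / (2 * a) with hk
    have hk' : 2 * a * k = a ^ 2 + b ^ 2 - c ^ 2 := by rw [hk]; field_simp
    have hle : k ^ 2 ≤ b ^ 2 := by
      have hlo : -(2 * a * b) ≤ 2 * a * k := by rw [hk']; nlinarith
      have hhi : 2 * a * k ≤ 2 * a * b := by rw [hk']; nlinarith
      apply sq_le_sq'
      · nlinarith
      · nlinarith
    refine ⟨!₂[a, 0], !₂[k, √(b ^ 2 - k ^ 2)], ?_, ?_, ?_⟩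
    · simp [EuclideanSpace.norm_eq, Fin.sum_univ_two, Real.sqrt_sq ha]
    · have : (√(b ^ 2 - k ^ 2)) ^ 2 = b ^ 2 - k ^ 2 := Real.sq_sqrt (by linarith)
      simp [EuclideanSpace.norm_eq, Fin.sum_univ_two, this, Real.sqrt_sq hb]
    · have : (√(b ^ 2 - k ^ 2)) ^ 2 = b ^ 2 - k ^ 2 := Real.sq_sqrt (by linarith)
      have e : (a - k) ^ 2 + (b ^ 2 - k ^ 2) = c ^ 2 := by linarith [sq_nonneg k]
      simp [EuclideanSpace.norm_eq, Fin.sum_univ_two, this, e, Real.sqrt_sq hc]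

/-- `p` divides the segment from `x` to `y` in the ratio `s : 1 - s`. -/
def IsAtRatio (x y : X) (s : ℝ) (p : X) : Prop :=
  dist x p = s * dist x y ∧ dist p y = (1 - s) * dist x y

theorem IsAtRatio.mem_seg (h : IsAtRatio x y s p) : p ∈ seg x y := by
  change dist x p + dist p y = dist x y
  rw [h.1, h.2]; ring

theorem IsAtRatio.symm (h : IsAtRatio x y s p) : IsAtRatio y x (1 - s) p := by
  refine ⟨?_, ?_⟩
  · rw [dist_comm y p, dist_comm y x, h.2]
  · rw [dist_comm p x, dist_comm y x, h.1]; ring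

theorem isAtRatio_one (x y : X) : IsAtRatio x y 1 y := by simp [IsAtRatio]

theorem exists_isAtRatio (hX : IsGeodesicSpace X) (x y : X) (hs : s ∈ Icc (0 : ℝ) 1) :
    ∃ p, IsAtRatio x y s p := by
  obtain ⟨c, hc, h0, h1⟩ := hX x y
  have n : 0 ≤ dist x y := dist_nonneg
  have m₀ : 0 ≤ s * dist x y := mul_nonneg hs.1 n
  have m₁ : s * dist x y ≤ dist x y := mul_le_of_le_one_left n hs.2
  have e₁ := hc 0 ⟨le_rfl, n⟩ (s * dist x y) ⟨m₀, m₁⟩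
  have e₂ := hc (s * dist x y) ⟨m₀, m₁⟩ (dist x y) ⟨n, le_rfl⟩
  rw [h0, abs_of_nonpos (by linarith)] at e₁
  rw [h1, abs_of_nonpos (by linarith)] at e₂
  exact ⟨c (s * dist x y), by rw [e₁]; ring, by rw [e₂]; ring⟩

theorem exists_ratio_of_mem_seg (h : p ∈ seg x y) : ∃ s ∈ Icc (0 : ℝ) 1, IsAtRatio x y s p := by
  have h' : dist x p + dist p y = dist x y := h
  have n₁ : 0 ≤ dist x p := dist_nonneg
  have n₂ : 0 ≤ dist p y := dist_nonneg
  rcases (dist_nonneg (x := x) (y := y)).eq_or_lt with h0 | h0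
  · refine ⟨0, by simp, ?_, ?_⟩ <;> rw [← h0] <;> linarith
  · refine ⟨dist x p / dist x y, ⟨by positivity, by rw [div_le_one h0]; linarith⟩, ?_, ?_⟩
    · field_simp
    · field_simp; linarith

theorem left_mem_seg (x y : X) : x ∈ seg x y := by simp [seg]

theorem right_mem_seg (x y : X) : y ∈ seg x y := by simp [seg]

theorem mem_seg_comm : p ∈ seg x y ↔ p ∈ seg y x := by
  simp only [seg, mem_ofPred_eq, dist_comm x p, dist_comm p y, dist_comm x y]
  rw [add_comm]

theorem seg_subset_seg_left (hw : w ∈ seg x y) : seg x w ⊆ seg x y := by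
  intro p hp
  change dist x p + dist p w = dist x w at hp
  change dist x w + dist w y = dist x y at hw
  change dist x p + dist p y = dist x y
  linarith [dist_triangle x p y, dist_triangle p w y]

theorem seg_subset_seg_right (hw : w ∈ seg x y) : seg w y ⊆ seg x y := by
  intro p hp
  rw [mem_seg_comm] at hw hp ⊢
  exact seg_subset_seg_left hw hp

theorem mem_seg_of_mem_seg (hw : w ∈ seg x y) (hp : p ∈ seg x w) : w ∈ seg p y := by
  change dist x p + dist p w = dist x w at hp
  change dist x w + dist w y = dist x y at hw
  change dist p w + dist w y = dist p y
  linarith [dist_triangle x p y, dist_triangle p w y]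

/-- The law of cosines form of the comparison axiom: the right-hand side is the squared distance
of the comparison points. -/
theorem IsCAT0.dist_sq_le (hX : IsCAT0 X) (hs : s ∈ Icc (0 : ℝ) 1) (ht : t ∈ Icc (0 : ℝ) 1)
    (hp : IsAtRatio x y s p) (hq : IsAtRatio x z t q) :
    dist p q ^ 2 ≤ s ^ 2 * dist x y ^ 2 + t ^ 2 * dist x z ^ 2 -
      s * t * (dist x y ^ 2 + dist x z ^ 2 - dist y z ^ 2) := by
  obtain ⟨u, v, hu, hv, huv⟩ := exists_comparison_triangle (dist_nonneg (x := x) (y := y))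
    (dist_nonneg (x := x) (y := z)) (dist_nonneg (x := y) (y := z))
    (by linarith [dist_triangle x z y, dist_comm y z]) (dist_triangle x y z)
    (by linarith [dist_triangle y x z, dist_comm x y])
  have abs₁ : |1 - s| = 1 - s := abs_of_nonneg (by linarith [hs.2])
  have abs₂ : |1 - t| = 1 - t := abs_of_nonneg (by linarith [ht.2])
  have es : s • u - u = -((1 - s) • u) := by module
  have et : t • v - v = -((1 - t) • v) := by module
  have key := hX.comparison x y z p q 0 u v (s • u) (t • v) hp.mem_seg hq.mem_seg
    (by simp [hu]) (by simp [hv]) (by rw [dist_eq_norm, huv])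
    (by rw [dist_zero_left, norm_smul, hu, hp.1, Real.norm_of_nonneg hs.1])
    (by rw [dist_eq_norm, es, norm_neg, norm_smul, hu, hp.2, Real.norm_eq_abs, abs₁])
    (by rw [dist_zero_left, norm_smul, hv, hq.1, Real.norm_of_nonneg ht.1])
    (by rw [dist_eq_norm, et, norm_neg, norm_smul, hv, hq.2, Real.norm_eq_abs, abs₂])
  have e₁ : ‖s • u - t • v‖ ^ 2 = s ^ 2 * ‖u‖ ^ 2 - 2 * (s * t * inner ℝ u v) +
      t ^ 2 * ‖v‖ ^ 2 := by
    rw [norm_sub_sq_real, norm_smul, norm_smul, inner_smul_left, inner_smul_right, mul_pow,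
      mul_pow, Real.norm_eq_abs, Real.norm_eq_abs, sq_abs, sq_abs]
    simp; ring
  have e₂ := norm_sub_sq_real u v
  rw [hu, hv, huv] at e₂
  rw [hu, hv] at e₁
  rw [dist_eq_norm] at key
  calc dist p q ^ 2 ≤ ‖s • u - t • v‖ ^ 2 := by gcongr
    _ = _ := by rw [e₁, e₂]; ring

/-- Stewart's theorem becomes an inequality in a CAT(0) space. -/
theorem IsCAT0.stewart (hX : IsCAT0 X) (hs : s ∈ Icc (0 : ℝ) 1) (hp : IsAtRatio x y s p) (z : X) :
    dist z p ^ 2 ≤ (1 - s) * dist z x ^ 2 + s * dist z y ^ 2 - s * (1 - s) * dist x y ^ 2 := by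
  have h := hX.dist_sq_le hs ⟨zero_le_one, le_rfl⟩ hp (isAtRatio_one x z)
  rw [dist_comm p z, dist_comm x z, dist_comm y z] at h
  linarith

theorem IsCAT0.isAtRatio_unique (hX : IsCAT0 X) (hs : s ∈ Icc (0 : ℝ) 1)
    (hp : IsAtRatio x y s p) (hq : IsAtRatio x y s q) : p = q := by
  have h := hX.stewart hs hp q
  rw [dist_comm q x, hq.1, hq.2] at h
  have h0 : dist q p ^ 2 ≤ 0 := by linarith
  have : dist q p = 0 := by nlinarith [sq_nonneg (dist q p)]
  exact (dist_eq_zero.mp this).symm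

theorem IsCAT0.eq_of_mem_seg (hX : IsCAT0 X) (hp : p ∈ seg x y) (hq : q ∈ seg x y)
    (h : dist x p = dist x q) : p = q := by
  obtain ⟨s, hs, h₁⟩ := exists_ratio_of_mem_seg hp
  refine hX.isAtRatio_unique hs h₁ ⟨by rw [← h, h₁.1], ?_⟩
  change dist x p + dist p y = dist x y at hp
  change dist x q + dist q y = dist x y at hq
  rw [← h₁.2]; linarith

/-- Two sides of a triangle, followed from their common vertex, diverge at least linearly. -/
theorem IsCAT0.dist_le_of_isAtRatio (hX : IsCAT0 X) (hs : s ∈ Icc (0 : ℝ) 1)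
    (hp : IsAtRatio x y s p) (hq : IsAtRatio x z s q) : dist p q ≤ s * dist y z := by
  have h := hX.dist_sq_le hs hs hp hq
  apply le_of_sq_le_sq _ (mul_nonneg hs.1 dist_nonneg)
  linarith

/-- The distance to `[x, z]` decreases along a side `[y, x]`; the bound is stated for the distance
of `y` to the end point `z`, which may be any point of a longer side. -/
theorem IsCAT0.exists_mem_seg_dist_le (hX : IsCAT0 X) (hp : p ∈ seg x y) (z : X) :
    ∃ q ∈ seg x z, dist p q ≤ dist y z := by
  obtain ⟨s, hs, h⟩ := exists_ratio_of_mem_seg hp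
  obtain ⟨q, hq⟩ := exists_isAtRatio hX.geodesic x z hs
  exact ⟨q, hq.mem_seg, (hX.dist_le_of_isAtRatio hs h hq).trans
    (mul_le_of_le_one_left dist_nonneg hs.2)⟩

/-- The distance of two points moving along opposite sides of a quadrilateral is convex. -/
theorem IsCAT0.dist_le_convex (hX : IsCAT0 X) (hs : s ∈ Icc (0 : ℝ) 1)
    (hp : IsAtRatio x y s p) (hq : IsAtRatio w z s q) :
    dist p q ≤ (1 - s) * dist x w + s * dist y z := by
  obtain ⟨m, hm⟩ := exists_isAtRatio hX.geodesic x z hs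
  have h₁ := hX.dist_le_of_isAtRatio hs hp hm
  have h₂ := hX.dist_le_of_isAtRatio (s := 1 - s) ⟨by linarith [hs.2], by linarith [hs.1]⟩
    hm.symm hq.symm
  linarith [dist_triangle p m q]

theorem IsCAT0.quadrilateral (hX : IsCAT0 X) (a b c d : X) :
    dist a c ^ 2 + dist b d ^ 2 ≤ dist a b ^ 2 + dist b c ^ 2 + dist c d ^ 2 + dist d a ^ 2 := by
  have hs : (1 / 2 : ℝ) ∈ Icc (0 : ℝ) 1 := by constructor <;> norm_num
  obtain ⟨m, hm⟩ := exists_isAtRatio hX.geodesic a c hs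
  have h₁ := hX.stewart hs hm b
  have h₂ := hX.stewart hs hm d
  have h₃ := dist_triangle b m d
  rw [dist_comm b a] at h₁
  rw [dist_comm d c] at h₂
  rw [dist_comm m d] at h₃
  have h₄ : dist b d ^ 2 ≤ (dist b m + dist d m) ^ 2 := by gcongr
  nlinarith [sq_nonneg (dist b m - dist d m)]

end Comparison

/-! ### Nearest point projections -/

section Projection

variable {X : Type u} [MetricSpace X] {x y z w p q v : X} {A I : Set X} {s t : ℝ} {c γ : ℝ → X}

theorem IsGeodesicOn.mem_seg {a b : ℝ} (hc : IsGeodesicOn (Icc a b) c) (ht : t ∈ Icc a b) :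
    c t ∈ seg (c a) (c b) := by
  have hab : a ≤ b := ht.1.trans ht.2
  change dist _ _ + dist _ _ = dist _ _
  rw [hc a ⟨le_rfl, hab⟩ t ht, hc t ht b ⟨hab, le_rfl⟩, hc a ⟨le_rfl, hab⟩ b ⟨hab, le_rfl⟩,
    abs_of_nonpos (by linarith [ht.1]), abs_of_nonpos (by linarith [ht.2]),
    abs_of_nonpos (by linarith)]
  ring

theorem IsGeodesicOn.continuousOn {I : Set ℝ} (hc : IsGeodesicOn I c) : ContinuousOn c I := by
  have : LipschitzOnWith 1 c I := LipschitzOnWith.of_dist_le_mul fun s hs t ht => by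
    rw [hc s hs t ht, Real.dist_eq]; simp
  exact this.continuousOn

theorem IsGeodesicOn.mono {I J : Set ℝ} (hc : IsGeodesicOn I c) (h : J ⊆ I) : IsGeodesicOn J c :=
  fun s hs t ht => hc s (h hs) t (h ht)

theorem IsCAT0.exists_geodesic (hX : IsCAT0 X) (x y : X) :
    ∃ c : ℝ → X, IsGeodesicOn (Icc 0 (dist x y)) c ∧ c 0 = x ∧ c (dist x y) = y ∧
      (∀ t ∈ Icc 0 (dist x y), c t ∈ seg x y) ∧ (∀ p ∈ seg x y, c (dist x p) = p) := by
  obtain ⟨c, hc, h0, h1⟩ := hX.geodesic x y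
  have hm : ∀ t ∈ Icc 0 (dist x y), c t ∈ seg x y := fun t ht => by
    have := hc.mem_seg ht
    rwa [h0, h1] at this
  refine ⟨c, hc, h0, h1, hm, fun p hp => ?_⟩
  have hp' : dist x p + dist p y = dist x y := hp
  have ht : dist x p ∈ Icc 0 (dist x y) :=
    ⟨dist_nonneg, by linarith [dist_nonneg (x := p) (y := y)]⟩
  refine hX.eq_of_mem_seg (hm _ ht) hp ?_
  have := hc 0 ⟨le_rfl, dist_nonneg⟩ _ ht
  rwa [h0, zero_sub, abs_neg, abs_of_nonneg dist_nonneg] at this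

/-- The sets to which the nearest point projection of a CAT(0) space is well behaved: nonempty and
convex, and such that nearest points exist. -/
structure IsProjConvex (A : Set X) : Prop where
  nonempty : A.Nonempty
  exists_proj : ∀ x, ∃ p, IsProj A x p
  seg_subset : ∀ p ∈ A, ∀ q ∈ A, seg p q ⊆ A

theorem IsCAT0.isProjConvex_image (hX : IsCAT0 X) {I : Set ℝ} (hne : I.Nonempty)
    (hI : I.OrdConnected) (hcl : IsClosed I) (hγ : IsGeodesicOn I γ) : IsProjConvex (γ '' I) where
  nonempty := hne.image γ
  exists_proj x := by
    obtain ⟨s₀, hs₀⟩ := hne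
    set d := dist x (γ s₀) with hd
    have hd0 : 0 ≤ d := dist_nonneg
    have hK : IsCompact (Icc (s₀ - 2 * d) (s₀ + 2 * d) ∩ I) := isCompact_Icc.inter_right hcl
    have hsK : s₀ ∈ Icc (s₀ - 2 * d) (s₀ + 2 * d) ∩ I := ⟨⟨by linarith, by linarith⟩, hs₀⟩
    have hcont : ContinuousOn (fun s => dist x (γ s)) (Icc (s₀ - 2 * d) (s₀ + 2 * d) ∩ I) :=
      (continuous_const.dist continuous_id).comp_continuousOn
        (hγ.continuousOn.mono inter_subset_right)
    obtain ⟨m, hm, hmin⟩ := hK.exists_isMinOn ⟨s₀, hsK⟩ hcont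
    refine ⟨γ m, mem_image_of_mem γ hm.2, ?_⟩
    rintro _ ⟨t, ht, rfl⟩
    by_cases h : t ∈ Icc (s₀ - 2 * d) (s₀ + 2 * d)
    · exact hmin ⟨h, ht⟩
    · have h₁ : dist x (γ m) ≤ d := hmin hsK
      have h₂ : 2 * d ≤ dist (γ s₀) (γ t) := by
        rw [hγ s₀ hs₀ t ht]
        by_contra! hlt
        rw [abs_lt] at hlt
        exact h ⟨by linarith [hlt.2], by linarith [hlt.1]⟩
      linarith [dist_triangle (γ s₀) x (γ t), dist_comm (γ s₀) x]
  seg_subset := by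
    have key : ∀ s ∈ I, ∀ t ∈ I, s ≤ t → seg (γ s) (γ t) ⊆ γ '' I := by
      intro s hs t ht hst p hp
      have hp' : dist (γ s) p + dist p (γ t) = dist (γ s) (γ t) := hp
      have e := hγ s hs t ht
      rw [abs_of_nonpos (by linarith)] at e
      have h₁ := dist_nonneg (x := γ s) (y := p)
      have h₂ := dist_nonneg (x := p) (y := γ t)
      have hsub : Icc s t ⊆ I := hI.out hs ht
      have hu : s + dist (γ s) p ∈ Icc s t := ⟨by linarith, by linarith⟩
      refine ⟨s + dist (γ s) p, hsub hu, ?_⟩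
      refine hX.eq_of_mem_seg ((hγ.mono hsub).mem_seg hu) hp ?_
      rw [hγ s hs _ (hsub hu), abs_of_nonpos (by linarith)]
      ring
    rintro _ ⟨s, hs, rfl⟩ _ ⟨t, ht, rfl⟩
    rcases le_total s t with h | h
    · exact key s hs t ht h
    · intro p hp
      exact key t ht s hs h (mem_seg_comm.mp hp)

theorem IsCAT0.isProjConvex_seg (hX : IsCAT0 X) (x y : X) : IsProjConvex (seg x y) := by
  obtain ⟨c, hc, h0, h1, hm, hp⟩ := hX.exists_geodesic x y
  have : seg x y = c '' Icc 0 (dist x y) := by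
    apply Subset.antisymm
    · intro p h
      have h' : dist x p + dist p y = dist x y := h
      exact ⟨dist x p, ⟨dist_nonneg, by linarith [dist_nonneg (x := p) (y := y)]⟩, hp p h⟩
    · rintro _ ⟨t, ht, rfl⟩
      exact hm t ht
  rw [this]
  exact hX.isProjConvex_image ⟨0, le_rfl, dist_nonneg⟩ ordConnected_Icc isClosed_Icc hc

theorem IsProj.infDist_eq (h : IsProj A x p) : Metric.infDist x A = dist x p :=
  le_antisymm (Metric.infDist_le_dist_of_mem h.1) ((Metric.le_infDist ⟨p, h.1⟩).2 fun {q} => h.2 q)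

theorem isProj_self (h : x ∈ A) : IsProj A x x := ⟨h, fun q _ => by simp⟩

theorem IsProj.of_mem_seg (h : IsProj A x p) (hw : w ∈ seg x p) : IsProj A w p := by
  refine ⟨h.1, fun q hq => ?_⟩
  have hw' : dist x w + dist w p = dist x p := hw
  linarith [h.2 q hq, dist_triangle x w q]

/-- The triangle with vertices `x`, its projection `p`, and any `q ∈ A` has an angle of at
least `π / 2` at `p`. -/
theorem IsCAT0.pythagoras (hX : IsCAT0 X) (hA : IsProjConvex A) (hp : IsProj A x p) (hq : q ∈ A) :
    dist x p ^ 2 + dist p q ^ 2 ≤ dist x q ^ 2 := by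
  by_contra! hlt
  set e := dist x p ^ 2 + dist p q ^ 2 - dist x q ^ 2 with he
  have he0 : 0 < e := by linarith
  have hden : 0 < dist p q ^ 2 + e := by positivity
  -- at a small ratio along `[p, q]`, Stewart's inequality would give a point closer to `x`
  set s := e / (2 * (dist p q ^ 2 + e)) with hs
  have hs0 : 0 < s := by positivity
  have hse : s * (2 * (dist p q ^ 2 + e)) = e := by rw [hs]; field_simp
  have hs1 : s ≤ 1 := by
    rw [hs, div_le_one (by positivity)]
    nlinarith [sq_nonneg (dist p q)]
  obtain ⟨m, hm⟩ := exists_isAtRatio hX.geodesic p q ⟨hs0.le, hs1⟩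
  have h₁ := hX.stewart ⟨hs0.le, hs1⟩ hm x
  have h₂ := hp.2 m (hA.seg_subset p hp.1 q hq hm.mem_seg)
  have h₃ : dist x p ^ 2 ≤ dist x m ^ 2 := by gcongr
  have h₄ : s * (e - s * dist p q ^ 2) ≤ 0 := by
    rw [he]; linarith
  have h₅ : e - s * dist p q ^ 2 ≤ 0 := by
    by_contra! h
    nlinarith [mul_pos hs0 h]
  nlinarith [mul_pos hs0 he0]

theorem IsCAT0.isProj_unique (hX : IsCAT0 X) (hA : IsProjConvex A) (hp : IsProj A x p)
    (hq : IsProj A x q) : p = q := by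
  have h₁ := hX.pythagoras hA hp hq.1
  have h₂ : dist x p = dist x q := le_antisymm (hp.2 q hq.1) (hq.2 p hp.1)
  rw [h₂] at h₁
  exact dist_eq_zero.mp (by nlinarith [sq_nonneg (dist p q)])

theorem IsCAT0.dist_proj_le (hX : IsCAT0 X) (hA : IsProjConvex A) (hp : IsProj A x p)
    (hq : IsProj A y q) : dist p q ≤ dist x y := by
  have h₁ := hX.pythagoras hA hp hq.1
  have h₂ := hX.pythagoras hA hq hp.1
  have h₃ := hX.quadrilateral x y q p
  rw [dist_comm q p] at h₂ h₃
  rw [dist_comm p x] at h₃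
  exact le_of_sq_le_sq (by linarith) dist_nonneg

/-- Along a geodesic that ends on a convex set, the distance to this set decreases. -/
theorem IsCAT0.infDist_le_of_mem_seg (hX : IsCAT0 X) (hA : IsProjConvex A) (hy : y ∈ A)
    (hw : w ∈ seg v y) : Metric.infDist w A ≤ Metric.infDist v A := by
  obtain ⟨p, hp⟩ := hA.exists_proj v
  obtain ⟨q, hq, h⟩ := hX.exists_mem_seg_dist_le (mem_seg_comm.mp hw) p
  rw [hp.infDist_eq]
  exact (Metric.infDist_le_dist_of_mem (hA.seg_subset y hy p hp.1 hq)).trans h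

end Projection

/-! ### Slim geodesics are contracting -/

section Slim

variable {X : Type u} [MetricSpace X] {A : Set X}

theorem IsContracting.mono {D D' : ℝ} (h : IsContracting D A) (hD : D ≤ D') :
    IsContracting D' A :=
  fun x y p q hp hq hxy => (h x y p q hp hq hxy).trans_le hD

/-- If the projections `p` and `q` of `x` and `y` are far apart and `o` is the midpoint of `[p, q]`,
then `[o, x]` and `[o, y]` start out along `[o, p]` and `[o, q]`, up to an error `δ`.  Hence the
comparison angle at `o` of the triangle `x o y` is at least `π / 2`, and `d(x, y) ≥ d(x, A)`. -/
theorem IsSlim.isContracting (hX : IsCAT0 X) (hA : IsProjConvex A) {δ : ℝ} (h : IsSlim δ A) :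
    IsContracting (14 * δ) A := by
  intro x y p q hp hq hxy
  by_contra! hl
  have hhalf : (1 / 2 : ℝ) ∈ Icc (0 : ℝ) 1 := by constructor <;> norm_num
  obtain ⟨o, ho⟩ := exists_isAtRatio hX.geodesic p q hhalf
  have hoA : o ∈ A := hA.seg_subset p hp.1 q hq.1 ho.mem_seg
  obtain ⟨p₁, hp₁, dp⟩ := (Metric.infDist_lt_iff ⟨x, left_mem_seg x o⟩).1 (h x o p hoA hp)
  obtain ⟨q₁, hq₁, dq⟩ := (Metric.infDist_lt_iff ⟨y, left_mem_seg y o⟩).1 (h y o q hoA hq)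
  obtain ⟨s, hs, hsp⟩ := exists_ratio_of_mem_seg (mem_seg_comm.mp hp₁)
  obtain ⟨t, ht, htq⟩ := exists_ratio_of_mem_seg (mem_seg_comm.mp hq₁)
  have h₁ := hX.dist_sq_le hs ht hsp htq
  have hX1 : dist x y < dist o x := hxy.trans_le (by rw [dist_comm o x]; exact hp.2 o hoA)
  have h₂ : dist x y ^ 2 ≤ dist o x ^ 2 := by gcongr
  have h₃ : 0 ≤ s * t * (dist o x ^ 2 + dist o y ^ 2 - dist x y ^ 2) :=
    mul_nonneg (mul_nonneg hs.1 ht.1) (by linarith [sq_nonneg (dist o y)])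
  have h₄ : dist p₁ q₁ ^ 2 ≤ dist o p₁ ^ 2 + dist o q₁ ^ 2 := by
    rw [hsp.1, htq.1, mul_pow, mul_pow]; linarith
  obtain ⟨ho₁, ho₂⟩ := ho
  have h₅ : dist o p₁ ≤ dist p q / 2 + δ := by
    linarith [dist_triangle o p p₁, dist_comm o p]
  have h₆ : dist o q₁ ≤ dist p q / 2 + δ := by
    linarith [dist_triangle o q q₁]
  have h₇ : dist p q - 2 * δ ≤ dist p₁ q₁ := by
    linarith [dist_triangle4 p p₁ q₁ q, dist_comm q q₁]
  have hδ : 0 < δ := dist_nonneg.trans_lt dp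
  have h₈ : (dist p q - 2 * δ) ^ 2 ≤ dist p₁ q₁ ^ 2 := by gcongr; linarith
  have h₉ : dist o p₁ ^ 2 ≤ (dist p q / 2 + δ) ^ 2 := by gcongr
  have h₁₀ : dist o q₁ ^ 2 ≤ (dist p q / 2 + δ) ^ 2 := by gcongr
  nlinarith

end Slim

/-! ### Concatenation of paths -/

section Concat

variable {X : Type u} {f g h : ℝ → X} {a b T K s t : ℝ}

/-- The path `f`, restricted to `[0, a]`, followed by the path `g`. -/
noncomputable def concat (f : ℝ → X) (a : ℝ) (g : ℝ → X) (t : ℝ) : X :=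
  if t ≤ a then f t else g (t - a)

theorem concat_of_le (ht : t ≤ a) : concat f a g t = f t := if_pos ht

theorem concat_of_lt (ht : a < t) : concat f a g t = g (t - a) := if_neg (not_le.2 ht)

theorem concat_zero (ha : 0 ≤ a) : concat f a g 0 = f 0 := concat_of_le ha

theorem concat_add (hb : 0 ≤ b) (hfg : f a = g 0) : concat f a g (a + b) = g b := by
  rcases hb.eq_or_lt with rfl | hb
  · rw [concat_of_le (by simp), add_zero, hfg]
  · rw [concat_of_lt (by linarith), add_sub_cancel_left]

variable [MetricSpace X]

/-- `f` is `1`-Lipschitz on `[0, T]`. -/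
def IsShort (T : ℝ) (f : ℝ → X) : Prop :=
  ∀ s t, 0 ≤ s → s ≤ t → t ≤ T → dist (f s) (f t) ≤ t - s

/-- The inverse of `f`, restricted to `[0, T]`, is `K`-Lipschitz. -/
def IsExpanding (K T : ℝ) (f : ℝ → X) : Prop :=
  ∀ s t, 0 ≤ s → s ≤ t → t ≤ T → t - s ≤ K * dist (f s) (f t)

theorem IsShort.concat (hf : IsShort a f) (hg : IsShort b g) (hfg : f a = g 0) :
    IsShort (a + b) (concat f a g) := by
  intro s t hs hst ht
  rcases le_or_gt t a with hta | hta
  · rw [concat_of_le hta, concat_of_le (hst.trans hta)]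
    exact hf s t hs hst hta
  · rw [concat_of_lt hta]
    rcases le_or_gt s a with hsa | hsa
    · rw [concat_of_le hsa]
      have h₁ := hf s a hs hsa le_rfl
      have h₂ := hg 0 (t - a) le_rfl (by linarith) (by linarith)
      rw [← hfg] at h₂
      linarith [dist_triangle (f s) (f a) (g (t - a))]
    · rw [concat_of_lt hsa]
      linarith [hg (s - a) (t - a) (by linarith) (by linarith) (by linarith)]

theorem IsExpanding.concat (hf : IsExpanding K a f) (hg : IsExpanding K b g)
    (hfg : ∀ s ∈ Icc 0 a, ∀ t ∈ Icc 0 b, a - s + t ≤ K * dist (f s) (g t)) :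
    IsExpanding K (a + b) (concat f a g) := by
  intro s t hs hst ht
  rcases le_or_gt t a with hta | hta
  · rw [concat_of_le hta, concat_of_le (hst.trans hta)]
    exact hf s t hs hst hta
  · rw [concat_of_lt hta]
    rcases le_or_gt s a with hsa | hsa
    · rw [concat_of_le hsa]
      linarith [hfg s ⟨hs, hsa⟩ (t - a) ⟨by linarith, by linarith⟩]
    · rw [concat_of_lt hsa]
      linarith [hg (s - a) (t - a) (by linarith) (by linarith) (by linarith)]

/-- The condition of `IsExpanding.concat` for a third path `h` passes to `concat f a g`. -/
theorem concat_cross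
    (hf : ∀ s ∈ Icc 0 a, ∀ t ∈ Icc 0 T, a - s + b + t ≤ K * dist (f s) (h t))
    (hg : ∀ s ∈ Icc 0 b, ∀ t ∈ Icc 0 T, b - s + t ≤ K * dist (g s) (h t)) :
    ∀ s ∈ Icc 0 (a + b), ∀ t ∈ Icc 0 T,
      a + b - s + t ≤ K * dist (concat f a g s) (h t) := by
  rintro s ⟨hs0, hs⟩ t ht
  rcases le_or_gt s a with hsa | hsa
  · rw [concat_of_le hsa]
    linarith [hf s ⟨hs0, hsa⟩ t ht]
  · rw [concat_of_lt hsa]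
    linarith [hg (s - a) ⟨by linarith, by linarith⟩ t ht]

theorem IsGeodesicOn.isShort (hf : IsGeodesicOn (Icc 0 a) f) : IsShort a f := fun s t hs hst ht => by
  rw [hf s ⟨hs, hst.trans ht⟩ t ⟨hs.trans hst, ht⟩, abs_of_nonpos (by linarith)]
  linarith

theorem IsGeodesicOn.isExpanding (hf : IsGeodesicOn (Icc 0 a) f) (hK : 1 ≤ K) :
    IsExpanding K a f := fun s t hs hst ht => by
  rw [hf s ⟨hs, hst.trans ht⟩ t ⟨hs.trans hst, ht⟩, abs_of_nonpos (by linarith)]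
  nlinarith

theorem IsShort.isQuasiGeodesicOn (hf : IsShort T f) (hf' : IsExpanding K T f) (hK : 1 ≤ K) :
    IsQuasiGeodesicOn K 0 0 T f := by
  have key : ∀ s t, 0 ≤ s → s ≤ t → t ≤ T →
      1 / K * |s - t| - 0 ≤ dist (f s) (f t) ∧ dist (f s) (f t) ≤ K * |s - t| + 0 := by
    intro s t hs hst ht
    have h₁ := hf s t hs hst ht
    have h₂ := hf' s t hs hst ht
    rw [abs_of_nonpos (by linarith : s - t ≤ 0)]
    refine ⟨?_, by nlinarith⟩
    rw [sub_zero, one_div, inv_mul_le_iff₀ (by linarith)]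
    linarith
  intro s hs t ht
  rcases le_total s t with h | h
  · exact key s t hs.1 h ht.2
  · rw [dist_comm, abs_sub_comm]
    exact key t s ht.1 h hs.2

/-- Four consecutive geodesic segments form a quasi-geodesic as soon as the distance of any two
points is comparable to the length of the part of the broken geodesic between them. -/
theorem IsCAT0.exists_isQuasiGeodesicOn_of_four (hX : IsCAT0 X) (hK : 1 ≤ K) (a b c d e : X)
    (h₁₂ : ∀ u ∈ seg a b, ∀ v ∈ seg b c, dist u b + dist b v ≤ K * dist u v)
    (h₂₃ : ∀ u ∈ seg b c, ∀ v ∈ seg c d, dist u c + dist c v ≤ K * dist u v)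
    (h₃₄ : ∀ u ∈ seg c d, ∀ v ∈ seg d e, dist u d + dist d v ≤ K * dist u v)
    (h₁₃ : ∀ u ∈ seg a b, ∀ v ∈ seg c d, dist u b + dist b c + dist c v ≤ K * dist u v)
    (h₂₄ : ∀ u ∈ seg b c, ∀ v ∈ seg d e, dist u c + dist c d + dist d v ≤ K * dist u v)
    (h₁₄ : ∀ u ∈ seg a b, ∀ v ∈ seg d e,
      dist u b + dist b c + dist c d + dist d v ≤ K * dist u v) :
    ∃ (T : ℝ) (σ : ℝ → X), 0 ≤ T ∧ IsQuasiGeodesicOn K 0 0 T σ ∧ σ 0 = a ∧ σ T = e ∧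
      d ∈ σ '' Icc 0 T := by
  have left : ∀ {x y : X} {f : ℝ → X}, IsGeodesicOn (Icc 0 (dist x y)) f → f 0 = x →
      ∀ s ∈ Icc 0 (dist x y), dist x (f s) = s := by
    intro x y f hf h0 s hs
    rw [← h0, hf 0 ⟨le_rfl, dist_nonneg⟩ s hs, zero_sub, abs_neg, abs_of_nonneg hs.1]
  have right : ∀ {x y : X} {f : ℝ → X}, IsGeodesicOn (Icc 0 (dist x y)) f → f (dist x y) = y →
      ∀ s ∈ Icc 0 (dist x y), dist (f s) y = dist x y - s := by
    intro x y f hf h1 s hs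
    conv_lhs => rw [← h1]
    rw [hf s hs _ ⟨dist_nonneg, le_rfl⟩, abs_of_nonpos (by linarith [hs.2])]
    ring
  obtain ⟨f₁, g₁, l₁, r₁, m₁, -⟩ := hX.exists_geodesic a b
  obtain ⟨f₂, g₂, l₂, r₂, m₂, -⟩ := hX.exists_geodesic b c
  obtain ⟨f₃, g₃, l₃, r₃, m₃, -⟩ := hX.exists_geodesic c d
  obtain ⟨f₄, g₄, l₄, r₄, m₄, -⟩ := hX.exists_geodesic d e
  have n₁ : 0 ≤ dist a b := dist_nonneg
  have n₂ : 0 ≤ dist b c := dist_nonneg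
  have n₃ : 0 ≤ dist c d := dist_nonneg
  have n₄ : 0 ≤ dist d e := dist_nonneg
  have j₁ : f₁ (dist a b) = f₂ 0 := r₁.trans l₂.symm
  have j₂ : concat f₁ (dist a b) f₂ (dist a b + dist b c) = f₃ 0 := by
    rw [concat_add n₂ j₁, r₂, l₃]
  have j₃ : concat (concat f₁ (dist a b) f₂) (dist a b + dist b c) f₃
      (dist a b + dist b c + dist c d) = f₄ 0 := by
    rw [concat_add n₃ j₂, r₃, l₄]
  have e₁₂ := (g₁.isExpanding hK).concat (g₂.isExpanding hK) fun s hs t ht => by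
    have := h₁₂ _ (m₁ s hs) _ (m₂ t ht)
    rwa [right g₁ r₁ s hs, left g₂ l₂ t ht] at this
  have e₁₂₃ := e₁₂.concat (g₃.isExpanding hK) <| concat_cross
    (fun s hs t ht => by
      have := h₁₃ _ (m₁ s hs) _ (m₃ t ht)
      rwa [right g₁ r₁ s hs, left g₃ l₃ t ht] at this)
    (fun s hs t ht => by
      have := h₂₃ _ (m₂ s hs) _ (m₃ t ht)
      rwa [right g₂ r₂ s hs, left g₃ l₃ t ht] at this)
  have e₁₂₃₄ := e₁₂₃.concat (g₄.isExpanding hK) <| concat_cross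
    (fun s hs t ht => by
      rcases le_or_gt s (dist a b) with hsa | hsa
      · rw [concat_of_le hsa]
        have := h₁₄ _ (m₁ s ⟨hs.1, hsa⟩) _ (m₄ t ht)
        rw [right g₁ r₁ s ⟨hs.1, hsa⟩, left g₄ l₄ t ht] at this
        linarith
      · rw [concat_of_lt hsa]
        have hs' : s - dist a b ∈ Icc 0 (dist b c) := ⟨by linarith, by linarith [hs.2]⟩
        have := h₂₄ _ (m₂ _ hs') _ (m₄ t ht)
        rw [right g₂ r₂ _ hs', left g₄ l₄ t ht] at this
        linarith)
    (fun s hs t ht => by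
      have := h₃₄ _ (m₃ s hs) _ (m₄ t ht)
      rwa [right g₃ r₃ s hs, left g₄ l₄ t ht] at this)
  have short := ((g₁.isShort.concat g₂.isShort j₁).concat g₃.isShort j₂).concat g₄.isShort j₃
  refine ⟨_, _, by positivity, short.isQuasiGeodesicOn e₁₂₃₄ hK, ?_, ?_,
    dist a b + dist b c + dist c d, ⟨by positivity, by linarith⟩, ?_⟩
  · rw [concat_zero (by positivity), concat_zero (by positivity), concat_zero n₁, l₁]
  · rw [concat_add n₄ j₃, r₄]
  · rw [concat_of_le le_rfl, j₃, l₄]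

end Concat

/-! ### Morse geodesics are slim -/

section Morse

variable {X : Type u} [MetricSpace X] {A : Set X}

/-- A segment that starts at a nearest point `e` to `n` on some set, and leads to `n`, does not
backtrack along this set. -/
theorem dist_add_dist_le_of_nearest {u v e n : X} (h : dist e n ≤ dist u n) (hv : v ∈ seg e n) :
    dist u e + dist e v ≤ 3 * dist u v := by
  change dist e v + dist v n = dist e n at hv
  linarith [dist_triangle u v n, dist_triangle u v e, dist_comm v e]

theorem IsMorse.pos {M : ℝ → ℝ → ℝ} (hM : IsMorse M A) (hne : A.Nonempty) {K L : ℝ} (hK : 1 ≤ K)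
    (hL : 0 ≤ L) : 0 < M K L := by
  obtain ⟨p, hp⟩ := hne
  by_contra! h
  have := hM K L hK hL 0 0 (fun _ => p) le_rfl (fun s hs t ht => by
    have e₁ : s = 0 := le_antisymm hs.2 hs.1
    have e₂ : t = 0 := le_antisymm ht.2 ht.1
    subst e₁ e₂
    simp [hL]) hp hp ⟨0, by simp, rfl⟩
  rw [Metric.thickening_of_nonpos h] at this
  exact this

/-- Suppose that `[x, y]`, with `y ∈ A`, stays `4 M` away from the projection `p` of `x`, where
`M = M(32, 0)`.  Let `z` be the point of `[x, y]` at height `M` above `A` and `z'` its projection.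
Choose `b` on `[p, x]` whose distance to `[x, z]` is one third of its height `h = d(p, b)`, and let
`c` be the point of `[x, z]` nearest to `b`.  The broken geodesic `p b c z z'` is then a
`(32, 0)`-quasi-geodesic, but it contains `z`. -/
theorem IsMorse.isSlim (hX : IsCAT0 X) (hA : IsProjConvex A) {M : ℝ → ℝ → ℝ} (hM : IsMorse M A) :
    IsSlim (4 * M 32 0) A := by
  intro x y p hy hp
  by_contra! hfar
  have hM0 : 0 < M 32 0 := hM.pos hA.nonempty (by norm_num) le_rfl
  set m := M 32 0 with hm
  obtain ⟨f, hf, f0, f1, fmem, -⟩ := hX.exists_geodesic x y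
  -- the point at height `m`
  obtain ⟨z, hz, hzm⟩ : ∃ z ∈ seg x y, Metric.infDist z A = m := by
    have hcont : ContinuousOn (fun s => Metric.infDist (f s) A) (Icc 0 (dist x y)) :=
      (Metric.continuous_infDist_pt A).comp_continuousOn hf.continuousOn
    have hx : m ≤ Metric.infDist (f 0) A := by
      rw [f0, hp.infDist_eq, dist_comm]
      linarith [Metric.infDist_le_dist_of_mem (x := p) (left_mem_seg x y)]
    have hy' : Metric.infDist (f (dist x y)) A ≤ m := by
      rw [f1, Metric.infDist_zero_of_mem hy]; exact hM0.le
    obtain ⟨s, hs, h⟩ := intermediate_value_Icc' dist_nonneg hcont ⟨hy', hx⟩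
    exact ⟨f s, fmem s hs, h⟩
  obtain ⟨z', hz'⟩ := hA.exists_proj z
  have hzz' : dist z z' = m := by rw [← hz'.infDist_eq, hzm]
  have hsub : seg x z ⊆ seg x y := seg_subset_seg_left hz
  have hhigh : ∀ v ∈ seg x z, m ≤ Metric.infDist v A := fun v hv => by
    rw [← hzm]
    exact hX.infDist_le_of_mem_seg hA hy (mem_seg_of_mem_seg hz hv)
  have hS := hX.isProjConvex_seg x z
  have hfar' : ∀ v ∈ seg x z, 4 * m ≤ dist p v := fun v hv =>
    hfar.trans (Metric.infDist_le_dist_of_mem (hsub hv))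
  -- the rung from `[p, x]` to `[x, z]`
  obtain ⟨g, hg, g0, g1, gmem, -⟩ := hX.exists_geodesic p x
  obtain ⟨b, hb, hbS⟩ : ∃ b ∈ seg p x, Metric.infDist b (seg x z) = dist p b / 3 := by
    have hcont : ContinuousOn (fun s => Metric.infDist (g s) (seg x z) - dist p (g s) / 3)
        (Icc 0 (dist p x)) :=
      ((Metric.continuous_infDist_pt _).comp_continuousOn hg.continuousOn).sub
        (((continuous_const.dist continuous_id).comp_continuousOn hg.continuousOn).div_const 3)
    have h0 : 0 ≤ Metric.infDist (g 0) (seg x z) - dist p (g 0) / 3 := by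
      rw [g0, dist_self]
      linarith [Metric.infDist_nonneg (x := p) (s := seg x z)]
    have h1 : Metric.infDist (g (dist p x)) (seg x z) - dist p (g (dist p x)) / 3 ≤ 0 := by
      rw [g1, Metric.infDist_zero_of_mem (left_mem_seg x z)]
      linarith [dist_nonneg (x := p) (y := x)]
    obtain ⟨s, hs, h⟩ := intermediate_value_Icc' dist_nonneg hcont ⟨h1, h0⟩
    exact ⟨g s, gmem s hs, by simpa [sub_eq_zero] using h⟩
  obtain ⟨c, hc⟩ := hS.exists_proj b
  set h := dist p b with hh
  have hbc : dist b c = h / 3 := by rw [← hc.infDist_eq, hbS]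
  have hbx : b ∈ seg x p := mem_seg_comm.mp hb
  -- the distance to `[x, z]` decreases along `[p, x]`
  have hmono : ∀ u ∈ seg p b, ∀ v ∈ seg x z, dist b c ≤ dist u v := by
    intro u hu v hv
    have hbu : b ∈ seg x u := mem_seg_comm.mp (mem_seg_of_mem_seg hb hu)
    obtain ⟨w, hw, hw'⟩ := hX.exists_mem_seg_dist_le hbu v
    exact (hc.2 w (seg_subset_seg_left hv hw)).trans hw'
  set ℓ := dist p z' with hℓ
  have hℓm : 3 * m ≤ ℓ := by
    linarith [hfar' z (right_mem_seg x z), dist_triangle p z' z, dist_comm z' z]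
  have hh₁ : h ≤ 3 * (ℓ + m) := by
    linarith [hmono p (left_mem_seg p b) z (right_mem_seg x z), dist_triangle p z' z,
      dist_comm z' z]
  have hh₂ : 3 * m ≤ h := by
    linarith [hfar' c hc.1, dist_triangle p b c]
  have hcz : seg c z ⊆ seg x z := seg_subset_seg_right hc.1
  have hpb : ∀ u ∈ seg p b, dist p u + dist u b = h := fun u hu => hu
  have hbc' : ∀ u ∈ seg b c, dist b u + dist u c = h / 3 := fun u hu => by rw [← hbc]; exact hu
  have hzz : ∀ u ∈ seg z z', dist z u + dist u z' = m := fun u hu => by rw [← hzz']; exact hu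
  have hproj_b : IsProj A b p := (hp.of_mem_seg hbx)
  have hheight_b : Metric.infDist b A = h := by rw [hproj_b.infDist_eq, dist_comm]
  obtain ⟨T, σ, hT, hσ, σ0, σT, hzσ⟩ := hX.exists_isQuasiGeodesicOn_of_four
    (K := 32) (by norm_num) p b c z z'
    (fun u hu v hv => by
      linarith [dist_add_dist_le_of_nearest (hmono u hu c hc.1) hv, dist_nonneg (x := u) (y := v)])
    (fun u hu v hv => by
      have : dist c b ≤ dist v b := by
        rw [dist_comm c, dist_comm v]; exact hc.2 v (hcz hv)
      linarith [dist_add_dist_le_of_nearest this (mem_seg_comm.mp hu), dist_nonneg (x := u) (y := v),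
        dist_comm u v, dist_comm u c, dist_comm v c])
    (fun u hu v hv => by
      have : dist z z' ≤ dist u z' := by
        rw [hzz']
        exact (hhigh u (hcz hu)).trans (Metric.infDist_le_dist_of_mem hz'.1)
      linarith [dist_add_dist_le_of_nearest this hv, dist_nonneg (x := u) (y := v)])
    (fun u hu v hv => by
      linarith [hmono u hu v (hcz hv), hpb u hu, dist_nonneg (x := p) (y := u),
        dist_triangle4 c b u v, dist_comm u b, dist_comm c b])
    (fun u hu v hv => by
      have h₁ := hzz v hv
      have h₂ := hbc' u hu
      have h₃ : h ≤ dist b u + dist u v + dist v z' := by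
        rw [← hheight_b]
        exact (Metric.infDist_le_dist_of_mem hz'.1).trans (dist_triangle4 b u v z')
      linarith [dist_nonneg (x := z) (y := v), dist_nonneg (x := u) (y := c),
        dist_nonneg (x := b) (y := u), dist_nonneg (x := v) (y := z'),
        dist_triangle4 c u v z, dist_comm c u, dist_comm v z])
    (fun u hu v hv => by
      have h₁ := hzz v hv
      have h₂ := hpb u hu
      have hub : u ∈ seg x p := mem_seg_comm.mp (seg_subset_seg_left hb hu)
      have h₃ : ℓ ≤ dist u v := hX.dist_proj_le hA (hp.of_mem_seg hub) (hz'.of_mem_seg hv)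
      linarith [dist_nonneg (x := z) (y := v), dist_nonneg (x := p) (y := u),
        dist_nonneg (x := v) (y := z'), dist_triangle4 c b u z, dist_triangle u v z,
        dist_comm c b, dist_comm b u, dist_comm v z])
  have hin := hM 32 0 (by norm_num) le_rfl 0 T σ hT hσ (by rw [σ0]; exact hp.1)
    (by rw [σT]; exact hz'.1) hzσ
  rw [Metric.mem_thickening_iff_infDist_lt hA.nonempty, hzm] at hin
  exact lt_irrefl _ hin

end Morse

/-! ### Contracting geodesics are Morse -/

section ContractingMorse

/-- Where `P` last holds before `s`, up to an error: the supremum of these places need not be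
attained, so there is a gap of length at most `1` between `t` and `u`. -/
theorem exists_left_boundary {P : ℝ → Prop} {a s : ℝ} (has : a ≤ s) (ha : P a) (hs : ¬ P s) :
    ∃ t u, a ≤ t ∧ t ≤ u ∧ u ≤ s ∧ u ≤ t + 1 ∧ P t ∧ ∀ v ∈ Icc u s, ¬ P v := by
  set S := {t | t ∈ Icc a s ∧ P t} with hS
  have haS : a ∈ S := ⟨⟨le_rfl, has⟩, ha⟩
  have hbdd : BddAbove S := ⟨s, fun t ht => ht.1.2⟩
  obtain ⟨t, ht, htS⟩ := exists_lt_of_lt_csSup ⟨a, haS⟩ (show sSup S - 1 / 2 < sSup S by linarith)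
  have hle : t ≤ sSup S := le_csSup hbdd ht
  refine ⟨t, min s (sSup S + 1 / 2), ht.1.1, le_min ht.1.2 (by linarith), min_le_left _ _,
    (min_le_right _ _).trans (by linarith), ht.2, ?_⟩
  rintro v ⟨hv, hvs⟩ hP
  rcases hvs.eq_or_lt with rfl | hvs'
  · exact hs hP
  · have : a ≤ v := by
      refine le_trans ?_ hv
      exact le_min has (by linarith [le_csSup hbdd haS])
    have h₁ := le_csSup hbdd (show v ∈ S from ⟨⟨this, hvs⟩, hP⟩)
    rcases min_le_iff.1 hv with h | h <;> linarith

theorem exists_right_boundary {P : ℝ → Prop} {b s : ℝ} (hsb : s ≤ b) (hb : P b) (hs : ¬ P s) :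
    ∃ t u, t ≤ b ∧ u ≤ t ∧ s ≤ u ∧ t ≤ u + 1 ∧ P t ∧ ∀ v ∈ Icc s u, ¬ P v := by
  obtain ⟨t, u, h₁, h₂, h₃, h₄, h₅, h₆⟩ := exists_left_boundary (P := fun t => P (-t))
    (neg_le_neg hsb) (by simpa using hb) (by simpa using hs)
  refine ⟨-t, -u, by linarith, by linarith, by linarith, by linarith, h₅, fun v hv => ?_⟩
  have := h₆ (-v) ⟨by linarith [hv.2], by linarith [hv.1]⟩
  simpa using this

variable {X : Type u} [MetricSpace X] {A : Set X}

/-- The Morse function of a `D`-contracting geodesic, for `D ≥ 1`.  Here `C` is a height at which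
a step of duration `2 * K * D` of a `(K, L)`-quasi-geodesic moves its projection by less than `D`,
and `T` bounds the duration of an excursion above this height. -/
def morseGauge (D K L : ℝ) : ℝ :=
  let C := K * (2 * K * D) + L + 1
  let T := 2 * K * (L + 2 * (C + K + L) + D)
  C + K + L + (K * T + L) + 1

/-- Far away from `A`, the projection of a quasi-geodesic to `A` moves slowly. -/
theorem IsContracting.dist_proj_le {D K L τ a b : ℝ} (hD : IsContracting D A) (hK : 0 ≤ K)
    (hτ : 0 ≤ τ) {σ π : ℝ → X} (hσ : IsQuasiGeodesicOn K L a b σ) (hπ : ∀ t, IsProj A (σ t) (π t))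
    (hfar : ∀ t ∈ Icc a b, K * τ + L < Metric.infDist (σ t) A) (n : ℕ) :
    ∀ u ∈ Icc a b, ∀ v ∈ Icc a b, u ≤ v → v - u ≤ n * τ → dist (π u) (π v) ≤ n * D := by
  induction n with
  | zero =>
    intro u hu v hv huv h
    have : u = v := by push_cast at h; linarith
    simp [this]
  | succ n ih =>
    intro u hu v hv huv h
    push_cast at h
    have hw : max u (v - τ) ∈ Icc a b :=
      ⟨hu.1.trans (le_max_left _ _), max_le hu.2 (by linarith [hv.2])⟩
    have hwv : max u (v - τ) ≤ v := max_le huv (by linarith)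
    have h₁ := ih u hu _ hw (le_max_left _ _)
      (by
        rw [sub_le_iff_le_add]
        exact max_le (by nlinarith [n.cast_nonneg (α := ℝ)]) (by linarith))
    have h₂ : dist (π (max u (v - τ))) (π v) < D := by
      refine hD _ _ _ _ (hπ _) (hπ v) ?_
      rw [← (hπ _).infDist_eq]
      refine lt_of_le_of_lt ?_ (hfar _ hw)
      refine (hσ _ hw v hv).2.trans ?_
      rw [abs_of_nonpos (by linarith)]
      have : -(max u (v - τ) - v) ≤ τ := by linarith [le_max_right u (v - τ)]
      gcongr
    push_cast
    linarith [dist_triangle (π u) (π (max u (v - τ))) (π v)]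

theorem IsContracting.isMorse (hA : IsProjConvex A) {D : ℝ} (hD : IsContracting D A)
    (hD1 : 1 ≤ D) : IsMorse (morseGauge D) A := by
  rintro K L hK hL a b σ hab hσ ha hb _ ⟨s, hs, rfl⟩
  rw [Metric.mem_thickening_iff_infDist_lt hA.nonempty]
  by_contra! hfar
  choose π hπ using fun t => hA.exists_proj (σ t)
  set τ := 2 * K * D with hτ
  have hτ0 : 0 < τ := by positivity
  set C := K * τ + L + 1 with hC
  have hC0 : 0 < C := by positivity
  set T := 2 * K * (L + 2 * (C + K + L) + D) with hT
  have hT0 : 0 ≤ T := by positivity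
  have hgauge : morseGauge D K L = C + K + L + (K * T + L) + 1 := rfl
  rw [hgauge] at hfar
  have hsC : ¬ Metric.infDist (σ s) A ≤ C := by
    have : 0 ≤ K * T := by positivity
    linarith
  obtain ⟨t₁, u₁, a₁, a₂, a₃, a₄, a₅, a₆⟩ := exists_left_boundary
    (P := fun t => Metric.infDist (σ t) A ≤ C) hs.1
    (by rw [Metric.infDist_zero_of_mem ha]; exact hC0.le) hsC
  obtain ⟨t₂, u₂, b₁, b₂, b₃, b₄, b₅, b₆⟩ := exists_right_boundary
    (P := fun t => Metric.infDist (σ t) A ≤ C) hs.2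
    (by rw [Metric.infDist_zero_of_mem hb]; exact hC0.le) hsC
  have hsub : Icc u₁ u₂ ⊆ Icc a b := Icc_subset_Icc (a₁.trans a₂) (b₂.trans b₁)
  have hu₁ : u₁ ∈ Icc u₁ u₂ := ⟨le_rfl, a₃.trans b₃⟩
  have hu₂ : u₂ ∈ Icc u₁ u₂ := ⟨a₃.trans b₃, le_rfl⟩
  -- the excursion starts and ends at bounded height
  have low : ∀ t u : ℝ, t ∈ Icc a b → u ∈ Icc a b → |t - u| ≤ 1 → Metric.infDist (σ t) A ≤ C →
      Metric.infDist (σ u) A ≤ C + K + L := by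
    intro t u ht hu htu h
    have h₁ := Metric.infDist_le_infDist_add_dist (s := A) (x := σ u) (y := σ t)
    have h₂ := (hσ t ht u hu).2
    rw [dist_comm] at h₂
    have h₃ : K * |t - u| ≤ K * 1 := by gcongr
    linarith
  have low₁ := low t₁ u₁ ⟨a₁, a₂.trans (hsub hu₁).2⟩ (hsub hu₁)
    (by rw [abs_le]; constructor <;> linarith) a₅
  have low₂ := low t₂ u₂ ⟨(hsub hu₂).1.trans b₂, b₁⟩ (hsub hu₂)
    (by rw [abs_le]; constructor <;> linarith) b₅
  -- hence it does not last long
  have hlen : u₂ - u₁ ≤ T := by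
    have hn := Nat.ceil_lt_add_one (show 0 ≤ (u₂ - u₁) / τ from
      div_nonneg (by linarith [hu₁.2]) hτ0.le)
    have h₁ := hD.dist_proj_le (by linarith) hτ0.le
      (fun s hs t ht => hσ s (hsub hs) t (hsub ht)) hπ
      (fun t ht => by
        have : C < Metric.infDist (σ t) A := by
          rcases le_total t s with h | h
          · exact not_le.1 (a₆ t ⟨ht.1, h⟩)
          · exact not_le.1 (b₆ t ⟨h, ht.2⟩)
        linarith) ⌈(u₂ - u₁) / τ⌉₊ u₁ hu₁ u₂ hu₂ hu₁.2
      (by rw [← div_le_iff₀ hτ0]; exact Nat.le_ceil _)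
    have h₂ : (⌈(u₂ - u₁) / τ⌉₊ : ℝ) * D ≤ ((u₂ - u₁) / τ + 1) * D := by gcongr
    have h₃ : (u₂ - u₁) / τ * D = 1 / K * (u₂ - u₁) / 2 := by
      rw [hτ]; field_simp
    have h₄ := (hσ u₁ (hsub hu₁) u₂ (hsub hu₂)).1
    rw [abs_of_nonpos (by linarith [hu₁.2])] at h₄
    rw [(hπ u₁).infDist_eq] at low₁
    rw [(hπ u₂).infDist_eq, dist_comm] at low₂
    have h₅ := dist_triangle4 (σ u₁) (π u₁) (π u₂) (σ u₂)
    have h₆ : 1 / K * (u₂ - u₁) ≤ 2 * (L + 2 * (C + K + L) + D) := by linarith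
    rw [one_div, inv_mul_le_iff₀ (by linarith)] at h₆
    rw [hT]; linarith
  have h₁ := Metric.infDist_le_infDist_add_dist (s := A) (x := σ s) (y := σ u₁)
  have h₂ := (hσ s hs u₁ (hsub hu₁)).2
  rw [abs_of_nonneg (by linarith)] at h₂
  have h₃ : K * (s - u₁) ≤ K * T := by gcongr; linarith
  linarith

end ContractingMorse

/-! ### Divergence of contracting geodesics -/

section Divergence

variable {X : Type u} [MetricSpace X] {A : Set X}

/-- A nearest point projection to a geodesic, as a map to its set of parameters. -/
theorem IsCAT0.exists_proj_coord (hX : IsCAT0 X) {I : Set ℝ} {γ : ℝ → X}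
    (hA : IsProjConvex (γ '' I)) (hγ : IsGeodesicOn I γ) :
    ∃ π : X → ℝ, Continuous π ∧ (∀ x, π x ∈ I) ∧ (∀ x, IsProj (γ '' I) x (γ (π x))) ∧
      ∀ t ∈ I, π (γ t) = t := by
  choose p hp using hA.exists_proj
  choose π hπ hπp using fun x => (hp x).1
  have hproj : ∀ x, IsProj (γ '' I) x (γ (π x)) := fun x => by rw [hπp x]; exact hp x
  refine ⟨π, ?_, hπ, hproj, ?_⟩
  · have : LipschitzWith 1 π := LipschitzWith.of_dist_le_mul fun x y => by
      rw [Real.dist_eq, ← hγ _ (hπ x) _ (hπ y)]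
      simpa using hX.dist_proj_le hA (hproj x) (hproj y)
    exact this.continuous
  · intro t ht
    have h₁ := hX.isProj_unique hA (hproj (γ t)) (isProj_self (mem_image_of_mem γ ht))
    have h₂ := hγ _ (hπ (γ t)) t ht
    rw [h₁, dist_self] at h₂
    linarith [abs_eq_zero.1 h₂.symm]

/-- While the projection of a path around the ball of radius `r` about `γ t` advances by `D` in
`[t - r / 2, t + r / 2]`, the path itself has to advance by `r / 2`. -/
theorem IsContracting.le_eVariationOn {I : Set ℝ} {γ : ℝ → X} (hγ : IsGeodesicOn I γ)
    {D : ℝ} (hD0 : 0 ≤ D) (hD : IsContracting D (γ '' I)) {π : X → ℝ} (hπ : Continuous π)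
    (hπI : ∀ x, π x ∈ I) (hπp : ∀ x, IsProj (γ '' I) x (γ (π x))) {r t : ℝ} (htI : t ∈ I)
    {x y : X} (β : Path x y) (hβ : ∀ s, r ≤ dist (β s) (γ t)) (hy : t + r / 2 ≤ π y) (n : ℕ) :
    ∀ s, t - r / 2 ≤ π (β s) → π (β s) + n * D ≤ t + r / 2 →
      ENNReal.ofReal (n * (r / 2)) ≤ eVariationOn β (Icc s 1) := by
  induction n with
  | zero => simp
  | succ n ih =>
    intro s hs hn
    push_cast at hn
    have hnD : 0 ≤ n * D := mul_nonneg n.cast_nonneg hD0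
    have hr : 0 ≤ r / 2 := by linarith
    have hcont : ContinuousOn (fun s => π (β s)) (Icc s 1) :=
      (hπ.comp β.continuous).continuousOn
    obtain ⟨s', hs', e⟩ := intermediate_value_Icc (unitInterval.le_one' (t := s)) hcont
      (show π (β s) + D ∈ Icc (π (β s)) (π (β 1)) from
        ⟨by linarith, by rw [β.target]; linarith⟩)
    have e' : π (β s') = π (β s) + D := e
    have h₁ := ih s' (by linarith) (by linarith)
    have h₂ : r / 2 ≤ dist (β s) (β s') := by
      by_contra! hlt
      have hheight : r / 2 ≤ dist (β s) (γ (π (β s))) := by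
        have h₃ := hγ _ (hπI (β s)) t htI
        have h₄ : |π (β s) - t| ≤ r / 2 := by rw [abs_le]; constructor <;> linarith
        linarith [hβ s, dist_triangle (β s) (γ (π (β s))) (γ t)]
      have h₃ := hD _ _ _ _ (hπp (β s)) (hπp (β s')) (hlt.trans_le hheight)
      rw [hγ _ (hπI _) _ (hπI _), e', abs_sub_comm, add_sub_cancel_left, abs_of_nonneg hD0] at h₃
      exact lt_irrefl _ h₃
    have h₃ : ENNReal.ofReal (r / 2) ≤ eVariationOn β (Icc s s') := by
      refine le_trans ?_ (eVariationOn.edist_le β (x := s) (y := s') ⟨le_rfl, hs'.1⟩ ⟨hs'.1, le_rfl⟩)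
      rw [edist_dist]
      exact ENNReal.ofReal_le_ofReal h₂
    have h₄ := eVariationOn.Icc_add_Icc β (s := univ) hs'.1 hs'.2 (mem_univ s')
    simp only [univ_inter] at h₄
    rw [← h₄]
    push_cast
    rw [add_mul, one_mul, add_comm, ENNReal.ofReal_add hr (mul_nonneg n.cast_nonneg hr)]
    exact add_le_add h₃ h₁

theorem IsContracting.isAtLeastQuadratic (hX : IsCAT0 X) {I : Set ℝ} {γ : ℝ → X}
    (hI : I.OrdConnected) (hA : IsProjConvex (γ '' I)) (hγ : IsGeodesicOn I γ) {D : ℝ}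
    (hD0 : 0 < D) (hD : IsContracting D (γ '' I)) :
    IsAtLeastQuadratic (lowerDivergence I γ) := by
  obtain ⟨π, hπ, hπI, hπp, hπγ⟩ := hX.exists_proj_coord hA hγ
  refine ⟨1 / (4 * D), by positivity, ?_⟩
  filter_upwards [eventually_ge_atTop (2 * D)] with r hr
  refine le_iInf₂ fun t ht => le_iInf₂ fun β hβ => ?_
  have h₁ : t - r ∈ I := interior_subset ht.1
  have h₂ : t + r ∈ I := interior_subset ht.2
  have htI : t ∈ I := hI.out h₁ h₂ ⟨by linarith, by linarith⟩
  have hcont : ContinuousOn (fun s => π (β s)) (Icc 0 1) := (hπ.comp β.continuous).continuousOn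
  obtain ⟨s, -, e⟩ := intermediate_value_Icc (zero_le_one' unitInterval) hcont
    (show t - r / 2 ∈ Icc (π (β 0)) (π (β 1)) by
      rw [β.source, β.target, hπγ _ h₁, hπγ _ h₂]
      constructor <;> linarith)
  have e' : π (β s) = t - r / 2 := e
  have hr0 : 0 ≤ r / D := div_nonneg (by linarith) hD0.le
  have hfl := Nat.floor_le hr0
  have h₃ := hD.le_eVariationOn hγ hD0.le hπ hπI hπp htI β hβ
    (by rw [hπγ _ h₂]; linarith) ⌊r / D⌋₊ s e'.ge
    (by
      rw [e']
      rw [le_div_iff₀ hD0] at hfl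
      linarith)
  refine (le_trans ?_ h₃).trans (eVariationOn.mono β (subset_univ _))
  refine ENNReal.ofReal_le_ofReal ?_
  have h₄ := (Nat.lt_floor_add_one (r / D)).le
  have h₅ : 2 ≤ r / D := by rw [le_div_iff₀ hD0]; exact hr
  calc 1 / (4 * D) * r ^ 2 = (r / D / 2) * (r / 2) := by field_simp; ring
    _ ≤ ⌊r / D⌋₊ * (r / 2) := mul_le_mul_of_nonneg_right (by linarith) (by linarith)

theorem IsAtLeastQuadratic.isSuperlinear {f : ℝ → ENNReal} (h : IsAtLeastQuadratic f) :
    IsSuperlinear f := by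
  obtain ⟨c, hc, h⟩ := h
  have hlim : Tendsto (fun r : ℝ => ENNReal.ofReal (c * r)) atTop (𝓝 ⊤) :=
    ENNReal.tendsto_ofReal_nhds_top.2 (tendsto_id.const_mul_atTop hc)
  refine tendsto_nhds_top_mono hlim ?_
  filter_upwards [h, eventually_gt_atTop 0] with r hr hr0
  rw [ENNReal.le_div_iff_mul_le (Or.inl (by simpa using hr0)) (Or.inl ENNReal.ofReal_ne_top),
    ← ENNReal.ofReal_mul (by positivity)]
  convert hr using 2
  ring

end Divergence

/-! ### Geodesics with superlinear divergence are contracting -/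

section Superlinear

variable {X : Type u} [MetricSpace X] {A I : Set X} {o x y z p : X} {r Λ Λ' : ℝ}

/-- `x` and `y` are joined by a path of length at most `Λ` outside the open ball of radius `r`
about `o`. -/
def HasDetour (o : X) (r Λ : ℝ) (x y : X) : Prop :=
  ∃ (T : ℝ) (f : ℝ → X), 0 ≤ T ∧ T ≤ Λ ∧ f 0 = x ∧ f T = y ∧ IsShort T f ∧
    ∀ s ∈ Icc 0 T, r ≤ dist (f s) o

theorem HasDetour.mono (h : HasDetour o r Λ x y) (hΛ : Λ ≤ Λ') : HasDetour o r Λ' x y := by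
  obtain ⟨T, f, h₁, h₂, h₃⟩ := h
  exact ⟨T, f, h₁, h₂.trans hΛ, h₃⟩

theorem HasDetour.symm (h : HasDetour o r Λ x y) : HasDetour o r Λ y x := by
  obtain ⟨T, f, h₁, h₂, h₃, h₄, h₅, h₆⟩ := h
  refine ⟨T, fun s => f (T - s), h₁, h₂, by simpa using h₄, by simpa using h₃, ?_, ?_⟩
  · intro s t hs hst ht
    rw [dist_comm]
    linarith [h₅ (T - t) (T - s) (by linarith) (by linarith) (by linarith)]
  · intro s hs
    exact h₆ _ ⟨by linarith [hs.2], by linarith [hs.1]⟩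

theorem HasDetour.trans (h : HasDetour o r Λ x y) (h' : HasDetour o r Λ' y z) :
    HasDetour o r (Λ + Λ') x z := by
  obtain ⟨T, f, h₁, h₂, h₃, h₄, h₅, h₆⟩ := h
  obtain ⟨T', f', h₁', h₂', h₃', h₄', h₅', h₆'⟩ := h'
  have hj : f T = f' 0 := h₄.trans h₃'.symm
  refine ⟨T + T', concat f T f', by linarith, by linarith, ?_, ?_, h₅.concat h₅' hj, ?_⟩
  · rw [concat_zero h₁, h₃]
  · rw [concat_add h₁' hj, h₄']
  · rintro s ⟨hs0, hs⟩
    rcases le_or_gt s T with hsT | hsT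
    · rw [concat_of_le hsT]
      exact h₆ s ⟨hs0, hsT⟩
    · rw [concat_of_lt hsT]
      exact h₆' _ ⟨by linarith, by linarith⟩

theorem IsCAT0.hasDetour (hX : IsCAT0 X) (h : ∀ v ∈ seg x y, r ≤ dist v o) :
    HasDetour o r (dist x y) x y := by
  obtain ⟨f, hf, h0, h1, hm, -⟩ := hX.exists_geodesic x y
  exact ⟨dist x y, f, dist_nonneg, le_rfl, h0, h1, hf.isShort, fun s hs => h _ (hm s hs)⟩

theorem IsGeodesicOn.hasDetour {J : Set ℝ} {γ : ℝ → X} (hγ : IsGeodesicOn J γ) {a b : ℝ}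
    (hab : a ≤ b) (hJ : Icc a b ⊆ J) (h : ∀ s ∈ Icc a b, r ≤ dist (γ s) o) :
    HasDetour o r (b - a) (γ a) (γ b) := by
  refine ⟨b - a, fun s => γ (a + s), by linarith, le_rfl, by simp, by simp, ?_, ?_⟩
  · intro s t hs hst ht
    rw [hγ _ (hJ ⟨by linarith, by linarith⟩) _ (hJ ⟨by linarith, by linarith⟩),
      abs_of_nonpos (by linarith)]
    linarith
  · intro s hs
    exact h _ ⟨by linarith [hs.1], by linarith [hs.2]⟩

theorem HasDetour.detour_le {γ : ℝ → X} {t : ℝ}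
    (h : HasDetour (γ t) r Λ (γ (t - r)) (γ (t + r))) : detour γ r t ≤ ENNReal.ofReal Λ := by
  obtain ⟨T, f, h₁, h₂, h₃, h₄, h₅, h₆⟩ := h
  have hlip : LipschitzOnWith 1 f (Icc 0 T) := LipschitzOnWith.of_dist_le_mul fun s hs t ht => by
    rw [NNReal.coe_one, one_mul, Real.dist_eq]
    rcases le_total s t with h | h
    · rw [abs_of_nonpos (by linarith)]
      linarith [h₅ s t hs.1 h ht.2]
    · rw [abs_of_nonneg (by linarith), dist_comm]
      linarith [h₅ t s ht.1 h hs.2]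
  have hmaps : ∀ s : unitInterval, T * (s : ℝ) ∈ Icc 0 T := fun s =>
    ⟨mul_nonneg h₁ s.2.1, mul_le_of_le_one_right h₁ s.2.2⟩
  have hcont : Continuous fun s : unitInterval => f (T * (s : ℝ)) :=
    hlip.continuousOn.comp_continuous (by fun_prop) hmaps
  let β : Path (γ (t - r)) (γ (t + r)) :=
    { toFun := fun s => f (T * (s : ℝ))
      continuous_toFun := hcont
      source' := by simpa using h₃
      target' := by simpa using h₄ }
  refine (iInf₂_le β fun s => h₆ _ (hmaps s)).trans ?_
  have hmono : Monotone fun s : unitInterval => T * (s : ℝ) := fun s s' hs =>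
    mul_le_mul_of_nonneg_left hs h₁
  have hv₁ := hlip.comp_eVariationOn_le (g := fun s : unitInterval => T * (s : ℝ)) (s := univ)
    fun s _ => hmaps s
  have hv₂ := ((hmono.monotoneOn univ).eVariationOn_eq (mem_univ 0) (mem_univ 1)).le
  have huniv : (univ : Set unitInterval) ∩ Icc 0 1 = univ := by
    rw [univ_inter]
    exact eq_univ_of_forall fun s => ⟨unitInterval.nonneg', unitInterval.le_one'⟩
  rw [huniv] at hv₂
  have hv₃ : eVariationOn β univ ≤
      (1 : NNReal) * eVariationOn (fun s : unitInterval => T * (s : ℝ)) univ := hv₁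
  rw [ENNReal.coe_one, one_mul] at hv₃
  refine (hv₃.trans hv₂).trans (ENNReal.ofReal_le_ofReal ?_)
  simpa using h₂

/-- If `[x, z]` stays at height at least `r`, then the projections `p` and `z'` of `x` and `z` are
joined by a path around the ball about `o`: it follows `[p, x]` up to a height proportional to
`d(p, z') + H`, crosses over to `[x, z]`, and follows `[x, z]` and `[z, z']`. -/
theorem IsCAT0.hasDetour_of_height (hX : IsCAT0 X) (hA : IsProjConvex A) {z' : X}
    (hp : IsProj A x p) (hz : IsProj A z z') {H : ℝ} (hr : 0 ≤ r)
    (hhigh : ∀ v ∈ seg x z, r ≤ Metric.infDist v A) (hH : dist z z' ≤ H) (ho : o ∈ A)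
    (hpo : r ≤ dist p o) (hzo : r ≤ dist z' o) :
    HasDetour o r (8 * (dist p z' + H)) p z' := by
  set ℓ := dist p z' with hℓ
  have hℓ0 : 0 ≤ ℓ := dist_nonneg
  have hrH : r ≤ H := by
    have := hhigh z (right_mem_seg x z)
    rw [hz.infDist_eq] at this
    linarith
  have hheight : ∀ v, Metric.infDist v A ≤ dist v o := fun v => Metric.infDist_le_dist_of_mem ho
  have hside : ∀ {w q : X}, IsProj A w q → r ≤ dist q o → ∀ v ∈ seg q w, r ≤ dist v o := by
    intro w q hq hqo v hv
    exact hqo.trans (hX.dist_proj_le hA (hq.of_mem_seg (mem_seg_comm.mp hv)) (isProj_self ho))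
  have hlast : HasDetour o r H z z' := by
    have := (hX.hasDetour (hside hz hzo)).symm
    rw [dist_comm] at this
    exact this.mono hH
  have hpz : dist p z ≤ ℓ + H := by linarith [dist_triangle p z' z, dist_comm z' z]
  rcases le_or_gt (dist x p) (2 * (ℓ + H)) with hR | hR
  · have h₁ := hX.hasDetour (hside hp hpo)
    have h₂ := hX.hasDetour fun v hv => (hhigh v hv).trans (hheight v)
    refine ((h₁.trans h₂).trans hlast).mono ?_
    linarith [dist_triangle x p z, dist_comm x p]
  · have hR0 : 0 < dist x p := by linarith
    set s := 1 - 2 * (ℓ + H) / dist x p with hs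
    have hs0 : 0 ≤ s := by
      rw [hs, sub_nonneg, div_le_one hR0]; exact hR.le
    have hs1 : s ≤ 1 := by
      rw [hs, sub_le_self_iff]; exact div_nonneg (by linarith) hR0.le
    obtain ⟨b, hb⟩ := exists_isAtRatio hX.geodesic x p ⟨hs0, hs1⟩
    obtain ⟨c, hc⟩ := exists_isAtRatio hX.geodesic x z ⟨hs0, hs1⟩
    have hbc : dist b c ≤ ℓ + H := (hX.dist_le_of_isAtRatio ⟨hs0, hs1⟩ hb hc).trans
      ((mul_le_of_le_one_left dist_nonneg hs1).trans hpz)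
    have hbp : dist b p = 2 * (ℓ + H) := by
      rw [hb.2, hs]; field_simp; ring
    have hpb := hp.of_mem_seg hb.mem_seg
    have h₁ := hX.hasDetour (hside hpb hpo)
    have h₂ : HasDetour o r (dist b c) b c := by
      refine hX.hasDetour fun v hv => le_trans ?_ (hheight v)
      change dist b v + dist v c = dist b c at hv
      have := Metric.infDist_le_infDist_add_dist (s := A) (x := b) (y := v)
      rw [hpb.infDist_eq] at this
      linarith [dist_nonneg (x := v) (y := c)]
    have h₃ := hX.hasDetour fun v hv =>
      (hhigh v (seg_subset_seg_right hc.mem_seg hv)).trans (hheight v)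
    refine (((h₁.trans h₂).trans h₃).trans hlast).mono ?_
    linarith [dist_triangle4 c b p z, dist_comm b c, dist_comm b p]

/-- The witness that `A` is not `4 r`-contracting can be modified to a segment `[x, z]` that stays
at height at least `r`, ends at height at most `8 r`, and whose end points have projections at
distance about `4 r`. -/
theorem IsCAT0.exists_high_segment (hX : IsCAT0 X) {I : Set ℝ} {γ : ℝ → X}
    (hA : IsProjConvex (γ '' I)) (hγ : IsGeodesicOn I γ) (hr : 0 < r)
    (hnot : ¬ IsContracting (4 * r) (γ '' I)) :
    ∃ x z : X, ∃ a ∈ I, ∃ b ∈ I, IsProj (γ '' I) x (γ a) ∧ IsProj (γ '' I) z (γ b) ∧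
      (∀ v ∈ seg x z, r ≤ Metric.infDist v (γ '' I)) ∧ dist z (γ b) ≤ 8 * r ∧
      3 * r ≤ |a - b| ∧ |a - b| ≤ 5 * r := by
  obtain ⟨π, hπ, hπI, hπp, -⟩ := hX.exists_proj_coord hA hγ
  set A := γ '' I with hAdef
  unfold IsContracting at hnot
  push Not at hnot
  obtain ⟨x, y, p, q, hp, hq, hxy, hpq⟩ := hnot
  obtain rfl := hX.isProj_unique hA hp (hπp x)
  obtain rfl := hX.isProj_unique hA hq (hπp y)
  have hdπ : ∀ u v, |π u - π v| = dist (γ (π u)) (γ (π v)) := fun u v =>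
    (hγ _ (hπI u) _ (hπI v)).symm
  have hdπ' : ∀ u v, |π u - π v| ≤ dist u v := fun u v => by
    rw [hdπ]; exact hX.dist_proj_le hA (hπp u) (hπp v)
  have hx : Metric.infDist x A = dist x (γ (π x)) := (hπp x).infDist_eq
  -- a point of `[x, y]` whose projection is at distance exactly `4 r` from that of `x`
  obtain ⟨z, hz, hπz⟩ : ∃ z ∈ seg x y, |π x - π z| = 4 * r := by
    obtain ⟨f, hf, f0, f1, hm, -⟩ := hX.exists_geodesic x y
    have hcont : ContinuousOn (fun s => |π x - π (f s)|) (Icc 0 (dist x y)) :=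
      (continuous_abs.comp (continuous_const.sub hπ)).comp_continuousOn hf.continuousOn
    obtain ⟨s, hs, h⟩ := intermediate_value_Icc dist_nonneg hcont
      (show 4 * r ∈ Icc |π x - π (f 0)| |π x - π (f (dist x y))| by
        rw [f0, f1, sub_self, abs_zero, hdπ]
        exact ⟨by linarith, hpq⟩)
    exact ⟨f s, hm s hs, h⟩
  have hxz : dist x z < dist x (γ (π x)) := by
    have hz' : dist x z + dist z y = dist x y := hz
    linarith [dist_nonneg (x := z) (y := y)]
  have h4 : 4 * r ≤ dist x z := by rw [← hπz]; exact hdπ' x z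
  by_cases hdip : ∃ v ∈ seg x z, Metric.infDist v A < r
  · -- `[x, z]` is cut off where it first reaches height `r`
    obtain ⟨f, hf, f0, f1, hm, hfp⟩ := hX.exists_geodesic x z
    have hcont : ContinuousOn (fun s => Metric.infDist (f s) A) (Icc 0 (dist x z)) :=
      (Metric.continuous_infDist_pt A).comp_continuousOn hf.continuousOn
    have hcpt : IsCompact (Icc 0 (dist x z) ∩ (fun s => Metric.infDist (f s) A) ⁻¹' {r}) :=
      isCompact_Icc.of_isClosed_subset (hcont.preimage_isClosed_of_isClosed isClosed_Icc
        isClosed_singleton) inter_subset_left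
    have hreach : ∀ s ∈ Icc 0 (dist x z), Metric.infDist (f s) A < r →
        ∃ t ∈ Icc 0 (dist x z) ∩ (fun s => Metric.infDist (f s) A) ⁻¹' {r}, t ≤ s := by
      intro s hs hlt
      obtain ⟨t, ht, e⟩ := intermediate_value_Icc' hs.1
        (hcont.mono (Icc_subset_Icc_right hs.2))
        (show r ∈ Icc (Metric.infDist (f s) A) (Metric.infDist (f 0) A) by
          rw [f0, hx]; exact ⟨hlt.le, by linarith⟩)
      exact ⟨t, ⟨⟨ht.1, ht.2.trans hs.2⟩, e⟩, ht.2⟩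
    have hpos : ∀ v ∈ seg x z, dist x v ∈ Icc 0 (dist x z) := fun v hv => by
      have hv' : dist x v + dist v z = dist x z := hv
      exact ⟨dist_nonneg, by linarith [dist_nonneg (x := v) (y := z)]⟩
    obtain ⟨v, hv, hvr⟩ := hdip
    obtain ⟨t, ht, -⟩ := hreach _ (hpos v hv) (by rw [hfp v hv]; exact hvr)
    obtain ⟨t₀, ⟨ht₀, e₀⟩, hleast⟩ := hcpt.exists_isLeast ⟨t, ht⟩
    have e₀' : Metric.infDist (f t₀) A = r := e₀
    have hz₁ : f t₀ ∈ seg x z := hm t₀ ht₀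
    have hd : dist x (f t₀) = t₀ := by
      rw [← f0, hf 0 ⟨le_rfl, dist_nonneg⟩ t₀ ht₀, zero_sub, abs_neg, abs_of_nonneg ht₀.1]
    have hclose : dist (f t₀) z < r := by
      have h₁ : dist x (f t₀) + dist (f t₀) z = dist x z := hz₁
      have h₂ := Metric.infDist_le_infDist_add_dist (s := A) (x := x) (y := f t₀)
      linarith
    have hcoord : |π (f t₀) - π z| < r := (hdπ' _ _).trans_lt hclose
    refine ⟨x, f t₀, π x, hπI x, π (f t₀), hπI _, hπp x, hπp _, ?_, ?_, ?_, ?_⟩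
    · intro w hw
      by_contra! hlt
      have hw' := seg_subset_seg_left hz₁ hw
      obtain ⟨t, ht, htle⟩ := hreach _ (hpos w hw') (by rw [hfp w hw']; exact hlt)
      have h₁ : dist x w + dist w (f t₀) = dist x (f t₀) := hw
      have h₂ : dist w (f t₀) ≤ 0 := by linarith [hleast ht]
      rw [dist_le_zero.1 h₂, e₀'] at hlt
      exact lt_irrefl _ hlt
    · rw [← (hπp (f t₀)).infDist_eq, e₀']; linarith
    · linarith [abs_sub_le (π x) (π (f t₀)) (π z)]
    · linarith [abs_sub_le (π x) (π z) (π (f t₀)), abs_sub_comm (π z) (π (f t₀))]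
  · push Not at hdip
    rcases le_or_gt (dist z (γ (π z))) (8 * r) with hH | hH
    · exact ⟨x, z, π x, hπI x, π z, hπI z, hπp x, hπp z, hdip, hH, by linarith, by linarith⟩
    · -- both end points are moved towards `A`, in the ratio that brings `z` to height `8 r`
      set H := dist (γ (π z)) z with hHdef
      rw [dist_comm] at hH
      have hH0 : 0 < H := by linarith
      set t := 8 * r / H with ht
      have ht01 : t ∈ Icc (0 : ℝ) 1 := ⟨by positivity, by rw [ht, div_le_one hH0]; exact hH.le⟩
      obtain ⟨x₁, hx₁⟩ := exists_isAtRatio hX.geodesic (γ (π x)) x ht01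
      obtain ⟨z₁, hz₁⟩ := exists_isAtRatio hX.geodesic (γ (π z)) z ht01
      have px₁ := (hπp x).of_mem_seg (mem_seg_comm.mp hx₁.mem_seg)
      have pz₁ := (hπp z).of_mem_seg (mem_seg_comm.mp hz₁.mem_seg)
      have hconv := hX.dist_le_convex ht01 hx₁ hz₁
      rw [← hdπ, hπz] at hconv
      have e₁ : Metric.infDist x₁ A = t * dist x (γ (π x)) := by
        rw [px₁.infDist_eq, dist_comm, hx₁.1, dist_comm x]
      have e₂ : dist z₁ (γ (π z)) = 8 * r := by
        rw [dist_comm, hz₁.1, ← hHdef, ht]; field_simp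
      have h₁ : t * dist x z ≤ t * dist x (γ (π x)) := mul_le_mul_of_nonneg_left hxz.le ht01.1
      have h₂ : (1 - t) * (4 * r) ≤ 4 * r :=
        mul_le_of_le_one_left (by linarith) (by linarith [ht01.1])
      refine ⟨x₁, z₁, π x, hπI x, π z, hπI z, px₁, pz₁, ?_, e₂.le, by linarith, by linarith⟩
      intro v hv
      have h₃ : dist x₁ v + dist v z₁ = dist x₁ z₁ := hv
      have h₄ := Metric.infDist_le_infDist_add_dist (s := A) (x := x₁) (y := v)
      have h₅ := Metric.infDist_le_infDist_add_dist (s := A) (x := z₁) (y := v)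
      rw [pz₁.infDist_eq, e₂, dist_comm] at h₅
      linarith

theorem IsCAT0.lowerDivergence_le (hX : IsCAT0 X) {I : Set ℝ} {γ : ℝ → X}
    (hI : I.OrdConnected) (hA : IsProjConvex (γ '' I)) (hγ : IsGeodesicOn I γ) (hr : 0 < r)
    (hnot : ¬ IsContracting (4 * r) (γ '' I)) :
    lowerDivergence I γ r ≤ ENNReal.ofReal (114 * r) := by
  have key : ∀ a ∈ I, ∀ b ∈ I, 3 * r ≤ b - a → b - a ≤ 5 * r →
      (∀ o ∈ γ '' I, r ≤ dist (γ a) o → r ≤ dist (γ b) o →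
        HasDetour o r (104 * r) (γ a) (γ b)) →
      lowerDivergence I γ r ≤ ENNReal.ofReal (114 * r) := by
    intro a ha b hb h₁ h₂ h
    have hsub : Icc a b ⊆ I := hI.out ha hb
    set t := (a + b) / 2 with ht
    have htI : t ∈ I := hsub ⟨by linarith, by linarith⟩
    have hint : Ioo a b ⊆ interior I :=
      interior_maximal (Ioo_subset_Icc_self.trans hsub) isOpen_Ioo
    have hfar : ∀ s ∈ I, r ≤ |s - t| → r ≤ dist (γ s) (γ t) := fun s hs hst => by
      rwa [hγ s hs t htI]
    have d₀ := h (γ t) (mem_image_of_mem γ htI)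
      (hfar a ha (by rw [abs_sub_comm, le_abs]; left; linarith))
      (hfar b hb (by rw [le_abs]; left; linarith))
    have d₁ := (hγ.hasDetour (o := γ t) (r := r) (show a ≤ t - r by linarith)
      ((Icc_subset_Icc_right (by linarith)).trans hsub) fun s hs =>
        hfar s (hsub ⟨hs.1, by linarith [hs.2]⟩)
          (by rw [abs_sub_comm, le_abs]; left; linarith [hs.2])).symm
    have d₂ := (hγ.hasDetour (o := γ t) (r := r) (show t + r ≤ b by linarith)
      ((Icc_subset_Icc_left (by linarith)).trans hsub) fun s hs =>
        hfar s (hsub ⟨by linarith [hs.1], hs.2⟩)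
          (by rw [le_abs]; left; linarith [hs.1])).symm
    exact (iInf₂_le t ⟨hint ⟨by linarith, by linarith⟩, hint ⟨by linarith, by linarith⟩⟩).trans
      (((d₁.trans d₀).trans d₂).mono (by linarith)).detour_le
  obtain ⟨x, z, a, ha, b, hb, hpa, hpb, hhigh, hH, h₁, h₂⟩ := hX.exists_high_segment hA hγ hr hnot
  have hdet : ∀ o ∈ γ '' I, r ≤ dist (γ a) o → r ≤ dist (γ b) o →
      HasDetour o r (104 * r) (γ a) (γ b) := fun o ho hao hbo =>
    (hX.hasDetour_of_height hA hpa hpb hr.le hhigh hH ho hao hbo).mono (by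
      rw [hγ a ha b hb]; linarith)
  rcases le_total a b with hab | hab
  · rw [abs_of_nonpos (by linarith)] at h₁ h₂
    exact key a ha b hb (by linarith) (by linarith) hdet
  · rw [abs_of_nonneg (by linarith)] at h₁ h₂
    exact key b hb a ha h₁ h₂ fun o ho hbo hao => (hdet o ho hao hbo).symm

theorem IsSuperlinear.exists_isContracting (hX : IsCAT0 X) {I : Set ℝ} {γ : ℝ → X}
    (hI : I.OrdConnected) (hA : IsProjConvex (γ '' I)) (hγ : IsGeodesicOn I γ)
    (h : IsSuperlinear (lowerDivergence I γ)) : ∃ D, IsContracting D (γ '' I) := by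
  by_contra! hnot
  obtain ⟨r, hr, hr0⟩ := ((h.eventually (lt_mem_nhds (ENNReal.ofReal_lt_top (r := 114)))).and
    (eventually_gt_atTop 0)).exists
  refine absurd hr (not_lt.2 (ENNReal.div_le_of_le_mul ?_))
  rw [← ENNReal.ofReal_mul (by norm_num)]
  exact hX.lowerDivergence_le hI hA hγ hr0 (hnot _)

end Superlinear

end CatZero

theorem mainTheorem2 :
    -- the five conditions on a geodesic ray or line are equivalent
    (∀ (X : Type u) [MetricSpace X], CatZero.IsCAT0 X →
      ∀ (I : Set ℝ) (α : ℝ → X), (I = Set.Ici 0 ∨ I = Set.univ) → CatZero.IsGeodesicOn I α →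
        List.TFAE [
          ∃ D : ℝ, CatZero.IsContracting D (α '' I),
          ∃ M : ℝ → ℝ → ℝ, CatZero.IsMorse M (α '' I),
          ∃ δ : ℝ, CatZero.IsSlim δ (α '' I),
          CatZero.IsSuperlinear (CatZero.lowerDivergence I α),
          CatZero.IsAtLeastQuadratic (CatZero.lowerDivergence I α)]) ∧
    -- the contraction constant determines a Morse function, for all geodesics in all spaces
    (∀ D : ℝ, ∃ M : ℝ → ℝ → ℝ, ∀ (X : Type u) [MetricSpace X], CatZero.IsCAT0 X →
      ∀ (I : Set ℝ) (γ : ℝ → X), I.Nonempty → I.OrdConnected → IsClosed I →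
        CatZero.IsGeodesicOn I γ →
        CatZero.IsContracting D (γ '' I) → CatZero.IsMorse M (γ '' I)) ∧
    -- the Morse function determines a contraction constant, explicitly
    (∀ (M : ℝ → ℝ → ℝ) (X : Type u) [MetricSpace X], CatZero.IsCAT0 X →
      ∀ (I : Set ℝ) (γ : ℝ → X), I.Nonempty → I.OrdConnected → IsClosed I →
        CatZero.IsGeodesicOn I γ →
        CatZero.IsMorse M (γ '' I) → CatZero.IsContracting (80 * M 32 0) (γ '' I)) := by
  refine ⟨?_, ?_, ?_⟩
  · intro X _ hX I α hI hα
    have hne : I.Nonempty := by rcases hI with rfl | rfl <;> exact ⟨0, by simp⟩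
    have hconn : I.OrdConnected := by
      rcases hI with rfl | rfl
      exacts [ordConnected_Ici, ordConnected_univ]
    have hcl : IsClosed I := by
      rcases hI with rfl | rfl
      exacts [isClosed_Ici, isClosed_univ]
    have hA := hX.isProjConvex_image hne hconn hcl hα
    tfae_have 1 → 2 := fun ⟨D, hD⟩ =>
      ⟨_, (hD.mono (le_max_left D 1)).isMorse hA (le_max_right D 1)⟩
    tfae_have 2 → 3 := fun ⟨M, hM⟩ => ⟨_, hM.isSlim hX hA⟩
    tfae_have 3 → 1 := fun ⟨δ, hδ⟩ => ⟨_, hδ.isContracting hX hA⟩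
    tfae_have 1 → 5 := fun ⟨D, hD⟩ =>
      (hD.mono (le_max_left D 1)).isAtLeastQuadratic hX hconn hA hα
        (zero_lt_one.trans_le (le_max_right D 1))
    tfae_have 5 → 4 := CatZero.IsAtLeastQuadratic.isSuperlinear
    tfae_have 4 → 1 := CatZero.IsSuperlinear.exists_isContracting hX hconn hA hα
    tfae_finish
  · intro D
    refine ⟨CatZero.morseGauge (max D 1), fun X _ hX I γ hne hconn hcl hγ hD => ?_⟩
    exact (hD.mono (le_max_left D 1)).isMorse (hX.isProjConvex_image hne hconn hcl hγ)
      (le_max_right D 1)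
  · intro M X _ hX I γ hne hconn hcl hγ hM
    have hA := hX.isProjConvex_image hne hconn hcl hγ
    have hM0 : 0 < M 32 0 := hM.pos hA.nonempty (by norm_num) le_rfl
    exact ((hM.isSlim hX hA).isContracting hX hA).mono (by linarith)
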